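/- Let $A$ be a non-zero $C^*$-algebra that is exact (that is, nuclearly embeddable). For a faithful $*$-representation $\pi : A \to \mathcal{B}(\mathcal{H})$, a finite set $\Omega \subseteq A$ and $\delta > 0$, let $\mathrm{CPA}(\pi,\Omega,\delta)$ be the collection of triples $(\varphi,\psi,F)$ where $F$ is a finite-dimensional $C^*$-algebra and $\varphi : A \to F$, $\psi : F \to \mathcal{B}(\mathcal{H})$ are contractive completely positive maps with $\|(\psi\circ\varphi)(a) - \pi(a)\| < \delta$ for all $a \in \Omega$. Let $\mathrm{rcp}(\Omega,\delta)$ be the infimum of $\mathrm{rank}\,F$ over all such triples, where $\mathrm{rank}\,F$ is the dimension of a maximal abelian $C^*$-subalgebra of $F$. For an automorphism $\alpha$ of $A$ put $$ht(\alpha,\Omega,\delta) = \limsup_{n\to\infty} \tfrac1n \log \mathrm{rcp}(\Omega \cup \alpha\Omega \cup \cdots \cup \alpha^{n-1}\Omega, \delta), \qquad ht(\alpha,\Omega) = \sup_{\delta>0} ht(\alpha,\Omega,\delta), \qquad ht(\alpha) = \sup_{\Omega} ht(\alpha,\Omega),$$ the last supremum being over all finite $\Omega \subseteq A$; these quantities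 do not depend on the choice of $\pi$. If $A$ is unital, let $ht'(\alpha,\Omega)$ be defined in the same way as $ht(\alpha,\Omega)$, but with $\pi$ unital and with unital completely positive maps $\varphi,\psi$ in place of contractive completely positive maps. An automorphism $\alpha$ of a unital exact $C^*$-algebra $A$ has *completely positive Voiculescu–Brown entropy* if $ht(\alpha|_B) > 0$ for every non-zero $C^*$-subalgebra $B \subseteq A$ (not necessarily containing the unit of $A$) with $\alpha(B) = B$ and $B \neq \mathbb{C}1$. **Proposition.** Let $\alpha$ be an automorphism of a non-zero unital exact $C^*$-algebra $A$. Then $\alpha$ has completely positive Voiculescu–Brown entropy if and only if $ht'(\alpha,\{u\}) > 0$ for every unitary $u \in A$ that is not a scalar multiple of $1$. -/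

import Mathlib

open Filter

universe u v w

noncomputable section

namespace VoiculescuBrown

/-- A linear map between C*-algebras is completely positive if all of its matrix amplifications
are positive (both algebras carry their unique C*-order). -/
def IsCompletelyPositive {A : Type u} {B : Type v} [NonUnitalCStarAlgebra A]
    [NonUnitalCStarAlgebra B] (f : A →ₗ[ℂ] B) : Prop :=
  letI : PartialOrder A := CStarAlgebra.spectralOrder A
  haveI : StarOrderedRing A := CStarAlgebra.spectralOrderedRing A
  letI : PartialOrder B := CStarAlgebra.spectralOrder B
  haveI : StarOrderedRing B := CStarAlgebra.spectralOrderedRing B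
  ∃ g : CompletelyPositiveMap A B, g.toLinearMap = f

/-- The rank of a finite-dimensional C*-algebra: the dimension of a maximal abelian
C*-subalgebra, that is, the largest dimension of an abelian C*-subalgebra. -/
def fdRank (F : Type u) [CStarAlgebra F] : ℕ :=
  sSup {d : ℕ | ∃ C : StarSubalgebra ℂ F,
    (∀ x ∈ C, ∀ y ∈ C, x * y = y * x) ∧ Module.finrank ℂ C = d}

/-- A faithful `*`-representation of a C*-algebra on a Hilbert space. -/
structure FaithfulRep (A : Type u) [NonUnitalCStarAlgebra A] where
  /-- The Hilbert space. -/
  H : Type v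
  [normed : NormedAddCommGroup H]
  [inner : InnerProductSpace ℂ H]
  [complete : CompleteSpace H]
  /-- The `*`-homomorphism into the bounded operators. -/
  hom : A →⋆ₙₐ[ℂ] (H →L[ℂ] H)
  injective : Function.Injective hom

attribute [instance] FaithfulRep.normed FaithfulRep.inner FaithfulRep.complete

section Approximation

variable {A : Type u} [NonUnitalCStarAlgebra A]

/-- `CPA π Ω δ` is the collection of triples `(φ, ψ, F)` where `F` is a finite-dimensional
C*-algebra and `φ : A → F`, `ψ : F → B(H)` are contractive completely positive maps with
`‖ψ (φ a) - π a‖ < δ` for all `a ∈ Ω`. -/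
structure CPA (π : FaithfulRep.{u, v} A) (Ω : Set A) (δ : ℝ) where
  /-- The finite-dimensional C*-algebra. -/
  F : Type
  [cstar : CStarAlgebra F]
  [finiteDim : FiniteDimensional ℂ F]
  /-- The map into the finite-dimensional algebra. -/
  φ : A →ₗ[ℂ] F
  /-- The map out of the finite-dimensional algebra. -/
  ψ : F →ₗ[ℂ] (π.H →L[ℂ] π.H)
  φ_cp : IsCompletelyPositive φ
  ψ_cp : IsCompletelyPositive ψ
  φ_contractive : ∀ a, ‖φ a‖ ≤ ‖a‖
  ψ_contractive : ∀ x, ‖ψ x‖ ≤ ‖x‖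
  approx : ∀ a ∈ Ω, ‖ψ (φ a) - π.hom a‖ < δ

attribute [instance] CPA.cstar CPA.finiteDim

/-- `rcp (Ω, δ)`: the infimum of the ranks over all approximating triples (`⊤` if there are
none). -/
def rcp (π : FaithfulRep.{u, v} A) (Ω : Set A) (δ : ℝ) : ℕ∞ :=
  ⨅ T : CPA π Ω δ, (fdRank T.F : ℕ∞)

/-- `Ω ∪ αΩ ∪ ⋯ ∪ αⁿ⁻¹Ω`. -/
def orbit (α : A ≃⋆ₐ[ℂ] A) (Ω : Set A) (n : ℕ) : Set A :=
  ⋃ i ∈ Finset.range n, (⇑α)^[i] '' Ω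

/-- The growth rate `limsup (1/n) log r(n)` of a sequence of extended natural numbers. -/
def growthRate (r : ℕ → ℕ∞) : EReal :=
  limsup (fun n : ℕ => ENNReal.log ((r n : ℕ∞) : ENNReal) / ((n : ℝ) : EReal)) atTop

/-- The local Voiculescu-Brown entropy `ht(α, Ω)`, computed in the representation `π`. -/
def htLocal (π : FaithfulRep.{u, v} A) (α : A ≃⋆ₐ[ℂ] A) (Ω : Set A) : EReal :=
  ⨆ (δ : ℝ) (_ : 0 < δ), growthRate fun n => rcp π (orbit α Ω n) δ

/-- The Voiculescu-Brown entropy `ht(α)`, computed in the representation `π`. -/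
def ht (π : FaithfulRep.{u, v} A) (α : A ≃⋆ₐ[ℂ] A) : EReal :=
  ⨆ (Ω : Set A) (_ : Ω.Finite), htLocal π α Ω

end Approximation

/-- A C*-algebra is exact if it has a faithful representation which is a point-norm limit of
compositions of contractive completely positive maps through finite-dimensional C*-algebras
(nuclear embeddability). -/
def IsExact (A : Type u) [NonUnitalCStarAlgebra A] : Prop :=
  ∃ π : FaithfulRep.{u, u} A, ∀ (Ω : Set A) (δ : ℝ), Ω.Finite → 0 < δ → Nonempty (CPA π Ω δ)

section Unital

variable {A : Type u} [CStarAlgebra A]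

/-- The approximating triples of `CPA π Ω δ` in which both maps are unital. -/
structure UnitalCPA (π : FaithfulRep.{u, v} A) (Ω : Set A) (δ : ℝ) extends CPA π Ω δ where
  φ_one : φ 1 = 1
  ψ_one : ψ 1 = 1

/-- The unital version of `rcp`. -/
def rcpUnital (π : FaithfulRep.{u, v} A) (Ω : Set A) (δ : ℝ) : ℕ∞ :=
  ⨅ T : UnitalCPA π Ω δ, (fdRank T.F : ℕ∞)

/-- The unital local Voiculescu-Brown entropy `ht'(α, Ω)`, computed in the (unital)
representation `π`. -/
def htUnital (π : FaithfulRep.{u, v} A) (α : A ≃⋆ₐ[ℂ] A) (Ω : Set A) : EReal :=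
  ⨆ (δ : ℝ) (_ : 0 < δ), growthRate fun n => rcpUnital π (orbit α Ω n) δ

/-- The set of scalars `ℂ1` of a unital C*-algebra. -/
def scalars (A : Type u) [CStarAlgebra A] : Set A := Set.range (algebraMap ℂ A)

/-- The restriction of an automorphism `α` of `A` to a C*-subalgebra `B` with `α(B) = B`. -/
def restrict (α : A ≃⋆ₐ[ℂ] A) (B : NonUnitalStarSubalgebra ℂ A)
    (h : α '' (B : Set A) = B) : B ≃⋆ₐ[ℂ] B where
  toFun x := ⟨α x, by
    have : α x ∈ (B : Set A) := h ▸ Set.mem_image_of_mem α x.2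
    exact this⟩
  invFun x := ⟨α.symm x, by
    have hx : (x : A) ∈ α '' (B : Set A) := by rw [h]; exact x.2
    obtain ⟨y, hy, hyx⟩ := hx
    rw [← hyx, StarAlgEquiv.symm_apply_apply]
    exact hy⟩
  left_inv x := Subtype.ext (α.symm_apply_apply x)
  right_inv x := Subtype.ext (α.apply_symm_apply x)
  map_mul' x y := Subtype.ext (map_mul α (x : A) y)
  map_add' x y := Subtype.ext (map_add α (x : A) y)
  map_star' x := Subtype.ext (map_star α (x : A))
  map_smul' c x := Subtype.ext (map_smul α c (x : A))

/-- Completely positive Voiculescu-Brown entropy of an automorphism `α` of a unital C*-algebra: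
`ht(α|_B) > 0` for every non-zero C*-subalgebra `B` with `α(B) = B` which is not equal to the
scalars. Here `ρ B` is the faithful representation of `B` in which `ht(α|_B)` is computed. -/
def HasCompletelyPositiveEntropy
    (ρ : ∀ (B : NonUnitalStarSubalgebra ℂ A) [IsClosed (B : Set A)], FaithfulRep.{u, v} B)
    (α : A ≃⋆ₐ[ℂ] A) : Prop :=
  ∀ (B : NonUnitalStarSubalgebra ℂ A) [IsClosed (B : Set A)] (hB : α '' (B : Set A) = B),
    B ≠ ⊥ → (B : Set A) ≠ scalars A → 0 < ht (ρ B) (restrict α B hB)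

end Unital

end VoiculescuBrown

end

noncomputable section

namespace VoiculescuBrown

set_option linter.unusedSectionVars false

/-! ### Complete positivity through matrices and through positive kernels. -/

section MatrixPositivity

open scoped ComplexOrder InnerProductSpace
open Matrix

variable {A : Type*} [NonUnitalCStarAlgebra A]
variable {K : Type*} [NormedAddCommGroup K] [InnerProductSpace ℂ K] [CompleteSpace K]

/-! Both implications compare ranks of approximations up to a shift in time and a fixed polynomial,
and neither turns subexponential growth into exponential growth (`growthRate_le_zero_of_le`).

Suppose every admissible invariant subalgebra has positive entropy, and let `x` be a non-scalar
unitary. The C*-algebra generated by the two-sided orbit of `x` is invariant, non-zero and not `ℂ1`.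
A unital completely positive map that almost agrees with a `*`-homomorphism at a unitary is almost
multiplicative there, by the Schwarz inequality, so agreement on a long enough piece of the orbit
forces agreement on any given finite subset of the generated algebra, uniformly in the maps
(`exists_uniform_agree`). Hence unital approximations of `n + 2N` steps of the orbit of `x` serve as
approximations of `n` steps of that finite set (`rcp_le_rcpUnital`), and positive entropy of the
subalgebra passes to `x`.

Conversely, let `B` be an admissible invariant subalgebra. Functional calculus gives a non-scalar
unitary `b + c1` with `b ∈ B` (`exists_nonscalar_unitary`), and approximations of `B` have to be
made unital and defined on all of `A`. For this `F` is embedded without the unit into some `B(K)`,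
and both maps are extended by Arveson's theorem (`exists_contractive_extension`). The map out of
`B(K)` can then be made unital; so can the map into it if `1 ∉ B`, and otherwise it is corrected by
a completely positive summand that is small after composition
(`KernelPositive.exists_unital_correction`). The rank grows only polynomially because `dim F ≤ (rank
F)²` (`finrank_le_fdRank_sq`).

Arveson's theorem is obtained from M. Riesz's extension theorem on a cone of operator kernels
(`exists_kernelPositive_extension`). It also moves approximations between faithful representations
(`exists_change_of_rep`), so the choices of `π` and `ρ` do not matter. -/

theorem nonneg_iff_exists_star_mul_self [PartialOrder A] [StarOrderedRing A] {a : A} :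
    0 ≤ a ↔ ∃ b, a = star b * b :=
  CStarAlgebra.nonneg_iff_eq_star_mul_self

/-- The witness is the negative part. Conjugating `a` by it gives `-c³`, so any form of positivity
that survives conjugation forces `c = 0`. -/
theorem exists_negPart [PartialOrder A] [StarOrderedRing A] {a : A} (ha : IsSelfAdjoint a) :
    ∃ c : A, 0 ≤ c ∧ a * c = -(c * c) ∧ (c = 0 → 0 ≤ a) := by
  refine ⟨a⁻, CFC.negPart_nonneg _, ?_, fun h => (CFC.negPart_eq_zero_iff a ha).mp h⟩
  have h := congrArg (· * a⁻) (CFC.posPart_sub_negPart a ha)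
  simpa [sub_mul] using h.symm

/-- Complete positivity, expressed without reference to an order. -/
theorem isCompletelyPositive_iff {A : Type u} {B : Type v} [NonUnitalCStarAlgebra A]
    [NonUnitalCStarAlgebra B] (f : A →ₗ[ℂ] B) :
    IsCompletelyPositive f ↔ ∀ (k : ℕ) (N : Matrix (Fin k) (Fin k) A),
      ∃ N' : Matrix (Fin k) (Fin k) B, (Nᴴ * N).map f = N'ᴴ * N' := by
  let _ : PartialOrder A := CStarAlgebra.spectralOrder A
  have _ : StarOrderedRing A := CStarAlgebra.spectralOrderedRing A
  let _ : PartialOrder B := CStarAlgebra.spectralOrder B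
  have _ : StarOrderedRing B := CStarAlgebra.spectralOrderedRing B
  constructor
  · rintro ⟨g, rfl⟩ k N
    have h := g.map_cstarMatrix_nonneg' k
      (star (CStarMatrix.ofMatrix N) * CStarMatrix.ofMatrix N) (star_mul_self_nonneg _)
    obtain ⟨N', hN'⟩ := nonneg_iff_exists_star_mul_self.mp h
    exact ⟨CStarMatrix.ofMatrix.symm N', hN'⟩
  · intro h
    refine ⟨⟨f, fun k M hM => ?_⟩, rfl⟩
    obtain ⟨N, rfl⟩ := nonneg_iff_exists_star_mul_self.mp hM
    obtain ⟨N', hN'⟩ := h k (CStarMatrix.ofMatrix.symm N)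
    exact nonneg_iff_exists_star_mul_self.mpr ⟨CStarMatrix.ofMatrix N', hN'⟩

theorem IsCompletelyPositive.comp {A : Type u} {B : Type v} {C : Type w} [NonUnitalCStarAlgebra A]
    [NonUnitalCStarAlgebra B] [NonUnitalCStarAlgebra C] {g : B →ₗ[ℂ] C} {f : A →ₗ[ℂ] B}
    (hg : IsCompletelyPositive g) (hf : IsCompletelyPositive f) :
    IsCompletelyPositive (g ∘ₗ f) := by
  rw [isCompletelyPositive_iff] at *
  intro k N
  obtain ⟨N', hN'⟩ := hf k N
  obtain ⟨N'', hN''⟩ := hg k N'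
  refine ⟨N'', ?_⟩
  rw [← hN'', ← hN', Matrix.map_map]
  rfl

/-- A `*`-homomorphism as a linear map. -/
abbrev homLin {A : Type u} {B : Type v} [NonUnitalCStarAlgebra A] [NonUnitalCStarAlgebra B]
    (σ : A →⋆ₙₐ[ℂ] B) : A →ₗ[ℂ] B where
  toFun := σ
  map_add' := map_add σ
  map_smul' := map_smul σ

theorem isCompletelyPositive_homLin {A : Type u} {B : Type v} [NonUnitalCStarAlgebra A]
    [NonUnitalCStarAlgebra B] (σ : A →⋆ₙₐ[ℂ] B) : IsCompletelyPositive (homLin σ) := by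
  rw [isCompletelyPositive_iff]
  intro k N
  refine ⟨N.map σ, ?_⟩
  ext i j
  simp [Matrix.mul_apply, map_star]

theorem sum_inner_conjTranspose_mul {m n : Type*} [Fintype m] [Fintype n]
    (N : Matrix m n (K →L[ℂ] K)) (x : n → K) :
    ∑ i, ∑ j, ⟪x i, (Nᴴ * N) i j (x j)⟫_ℂ = ((∑ t, ‖∑ j, N t j (x j)‖ ^ 2 : ℝ) : ℂ) := by
  have h1 : ∀ t, ((‖∑ j, N t j (x j)‖ ^ 2 : ℝ) : ℂ) =
      ∑ i, ∑ j, ⟪N t i (x i), N t j (x j)⟫_ℂ := by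
    intro t
    have := inner_self_eq_norm_sq_to_K (𝕜 := ℂ) (∑ j : n, N t j (x j))
    push_cast
    simp only [Complex.coe_algebraMap] at this
    rw [← this, sum_inner]
    simp_rw [inner_sum]
  rw [Complex.ofReal_sum]
  simp_rw [h1]
  have h2 : ∀ i j, ⟪x i, (Nᴴ * N) i j (x j)⟫_ℂ = ∑ t, ⟪N t i (x i), N t j (x j)⟫_ℂ := by
    intro i j
    simp only [Matrix.mul_apply, Matrix.conjTranspose_apply, _root_.sum_apply, inner_sum,
      mul_apply_eq_comp, ContinuousLinearMap.star_eq_adjoint,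
      ContinuousLinearMap.adjoint_inner_right]
  simp_rw [h2]
  exact (Finset.sum_congr rfl fun i _ => Finset.sum_comm).trans Finset.sum_comm

theorem sum_inner_conjTranspose_mul_nonneg {m n : Type*} [Fintype m] [Fintype n]
    (N : Matrix m n (K →L[ℂ] K)) (x : n → K) :
    0 ≤ ∑ i, ∑ j, ⟪x i, (Nᴴ * N) i j (x j)⟫_ℂ := by
  rw [sum_inner_conjTranspose_mul]
  exact Complex.zero_le_real.mpr (Finset.sum_nonneg fun t _ => by positivity)

/-- The change of variables `x = C y` in the quadratic form of an operator matrix. -/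
theorem sum_inner_mul_mul {n : Type*} [Fintype n] (C M : Matrix n n (K →L[ℂ] K)) (y : n → K) :
    ∑ i, ∑ j, ⟪∑ k, C i k (y k), M i j (∑ k, C j k (y k))⟫_ℂ =
      ∑ i, ∑ j, ⟪y i, (Cᴴ * M * C) i j (y j)⟫_ℂ := by
  have h2 : ∀ i j, ⟪y i, (Cᴴ * M * C) i j (y j)⟫_ℂ =
      ∑ l, ∑ k, ⟪C k i (y i), M k l (C l j (y j))⟫_ℂ := by
    intro i j
    simp only [Matrix.mul_apply, Matrix.conjTranspose_apply, _root_.sum_apply,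
      inner_sum, mul_apply_eq_comp, ContinuousLinearMap.star_eq_adjoint,
      ContinuousLinearMap.adjoint_inner_right, Finset.sum_mul]
  simp_rw [h2, map_sum, sum_inner, inner_sum]
  calc _ = ∑ i, ∑ k, ∑ j, ∑ l, ⟪C i k (y k), M i j (C j l (y l))⟫_ℂ := by
        refine Finset.sum_congr rfl fun i _ => ?_
        rw [Finset.sum_comm]
    _ = ∑ k, ∑ i, ∑ j, ∑ l, ⟪C i k (y k), M i j (C j l (y l))⟫_ℂ := Finset.sum_comm
    _ = ∑ k, ∑ i, ∑ l, ∑ j, ⟪C i k (y k), M i j (C j l (y l))⟫_ℂ := by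
        refine Finset.sum_congr rfl fun i _ => Finset.sum_congr rfl fun j _ => ?_
        rw [Finset.sum_comm]
    _ = ∑ k, ∑ l, ∑ i, ∑ j, ⟪C i k (y k), M i j (C j l (y l))⟫_ℂ := by
        refine Finset.sum_congr rfl fun i _ => Finset.sum_comm
    _ = _ := by
        refine Finset.sum_congr rfl fun i _ => Finset.sum_congr rfl fun j _ => Finset.sum_comm

/-- Polarization: the form is real on the diagonal, and its values at `x + y` and `x + iy` then give
hermitian symmetry. Vectors supported at one index recover the entries. -/
theorem conjTranspose_eq_of_sum_inner_nonneg {k : ℕ} (M : Matrix (Fin k) (Fin k) (K →L[ℂ] K))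
    (hM : ∀ x : Fin k → K, 0 ≤ ∑ i, ∑ j, ⟪x i, M i j (x j)⟫_ℂ) : Mᴴ = M := by
  set F : (Fin k → K) → (Fin k → K) → ℂ := fun x y => ∑ i, ∑ j, ⟪x i, M i j (y j)⟫_ℂ with hF
  have hre : ∀ x, star (F x x) = F x x := fun x => (IsSelfAdjoint.of_nonneg (hM x)).star_eq
  have hadd : ∀ x y, F (x + y) (x + y) = F x x + F x y + F y x + F y y := by
    intro x y
    simp only [hF, Pi.add_apply, map_add, inner_add_left, inner_add_right, Finset.sum_add_distrib]
    ring
  have hsm : ∀ (c : ℂ) x y, F x (c • y) = c * F x y := by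
    intro c x y
    simp only [hF, Pi.smul_apply, map_smul, inner_smul_right, Finset.mul_sum]
  have hsm' : ∀ (c : ℂ) x y, F (c • x) y = star c * F x y := by
    intro c x y
    simp only [hF, Pi.smul_apply, inner_smul_left, Finset.mul_sum]
    rfl
  have key : ∀ x y, star (F x y) = F y x := by
    intro x y
    have h1 : star (F x y + F y x) = F x y + F y x := by
      have : F x y + F y x = F (x + y) (x + y) - F x x - F y y := by rw [hadd]; ring
      rw [this, star_sub, star_sub, hre, hre, hre]
    have h2 : star (Complex.I * F x y - Complex.I * F y x) =
        Complex.I * F x y - Complex.I * F y x := by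
      have : Complex.I * F x y - Complex.I * F y x =
          F (x + Complex.I • y) (x + Complex.I • y) - F x x
            - F (Complex.I • y) (Complex.I • y) := by
        rw [hadd, hsm Complex.I x, hsm' Complex.I y x]
        simp only [Complex.star_def, Complex.conj_I]
        ring
      rw [this, star_sub, star_sub, hre, hre, hre]
    simp only [star_add, star_sub, star_mul', Complex.star_def, Complex.conj_I] at h1 h2 ⊢
    linear_combination (1 / 2 : ℂ) * h1 + (Complex.I / 2) * h2 +
      (1 / 2 : ℂ) * ((starRingEnd ℂ) (F x y) - (starRingEnd ℂ) (F y x) + F x y - F y x)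
        * Complex.I_sq
  have hs : ∀ i j (a b : K), F (Pi.single i a) (Pi.single j b) = ⟪a, M i j b⟫_ℂ := by
    intro i j a b
    simp only [hF]
    rw [Finset.sum_eq_single i, Finset.sum_eq_single j]
    · simp
    · intro l _ hl; simp [Pi.single_eq_of_ne hl]
    · simp
    · intro l _ hl; simp [Pi.single_eq_of_ne hl]
    · simp
  ext i j b
  refine ext_inner_left ℂ fun a => ?_
  rw [Matrix.conjTranspose_apply, ContinuousLinearMap.star_eq_adjoint,
    ContinuousLinearMap.adjoint_inner_right, ← inner_conj_symm, ← hs, ← hs]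
  exact key _ _

/-- With `c` the negative part of `M` and `c³ = n*n`, the form of `M` at `c y` equals `-‖n y‖²`.
Nonnegativity kills `n`, hence `c³`, hence `c`. -/
theorem exists_eq_conjTranspose_mul {k : ℕ} (M : Matrix (Fin k) (Fin k) (K →L[ℂ] K))
    (hM : ∀ x : Fin k → K, 0 ≤ ∑ i, ∑ j, ⟪x i, M i j (x j)⟫_ℂ) : ∃ N, M = Nᴴ * N := by
  have hsa : IsSelfAdjoint (CStarMatrix.ofMatrix M) :=
    conjTranspose_eq_of_sum_inner_nonneg M hM
  obtain ⟨c, hcn, hMc, hpos⟩ := exists_negPart hsa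
  have hcs : star c = c := (IsSelfAdjoint.of_nonneg hcn).star_eq
  have h3 : 0 ≤ c * c * c := by
    have := star_left_conjugate_nonneg hcn c
    rwa [hcs] at this
  obtain ⟨n, hn⟩ := nonneg_iff_exists_star_mul_self.mp h3
  have hn0 : n = 0 := by
    have hz : ∀ y : Fin k → K, ∑ t, ‖∑ j, CStarMatrix.ofMatrix.symm n t j (y j)‖ ^ 2 = 0 := by
      intro y
      have h5 := hM fun i => ∑ k, CStarMatrix.ofMatrix.symm c i k (y k)
      rw [sum_inner_mul_mul] at h5
      have h6 : (CStarMatrix.ofMatrix.symm c)ᴴ * M * CStarMatrix.ofMatrix.symm c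
          = -((CStarMatrix.ofMatrix.symm n)ᴴ * CStarMatrix.ofMatrix.symm n) := by
        have : star c * (CStarMatrix.ofMatrix M) * c = -(star n * n) := by
          rw [← hn, hcs, mul_assoc, hMc, mul_neg, mul_assoc]
        exact this
      rw [h6] at h5
      simp only [Matrix.neg_apply, _root_.neg_apply, inner_neg_right,
        Finset.sum_neg_distrib, sum_inner_conjTranspose_mul] at h5
      have h7 : (0 : ℝ) ≤ -∑ t, ‖∑ j, CStarMatrix.ofMatrix.symm n t j (y j)‖ ^ 2 := by
        exact_mod_cast h5
      have h8 : (0 : ℝ) ≤ ∑ t, ‖∑ j, CStarMatrix.ofMatrix.symm n t j (y j)‖ ^ 2 :=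
        Finset.sum_nonneg fun t _ => by positivity
      linarith
    refine CStarMatrix.ext fun t j => ?_
    ext b
    have := hz (Pi.single j b)
    rw [Finset.sum_eq_zero_iff_of_nonneg fun t _ => by positivity] at this
    have := this t (Finset.mem_univ t)
    rw [Finset.sum_eq_single j] at this
    · simpa using this
    · intro l _ hl; simp [Pi.single_eq_of_ne hl]
    · simp
  have hc0 : c = 0 := by
    have h1 : c * c * c = 0 := by rw [hn, hn0, mul_zero]
    have h2 : c * c = 0 := by
      rw [← CStarRing.star_mul_self_eq_zero_iff, star_mul, hcs, ← mul_assoc, h1, zero_mul]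
    rwa [← CStarRing.star_mul_self_eq_zero_iff, hcs]
  obtain ⟨N, hN⟩ := nonneg_iff_exists_star_mul_self.mp (hpos hc0)
  exact ⟨CStarMatrix.ofMatrix.symm N, hN⟩

/-- Positivity of all the kernels `(i, j) ↦ φ (aᵢ* aⱼ)`. -/
def KernelPositive (φ : A →ₗ[ℂ] (K →L[ℂ] K)) : Prop :=
  ∀ (k : ℕ) (a : Fin k → A) (x : Fin k → K), 0 ≤ ∑ i, ∑ j, ⟪x i, φ (star (a i) * a j) (x j)⟫_ℂ

theorem IsCompletelyPositive.kernelPositive {φ : A →ₗ[ℂ] (K →L[ℂ] K)}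
    (h : IsCompletelyPositive φ) : KernelPositive φ := by
  rw [isCompletelyPositive_iff] at h
  rintro (_ | k) a x
  · simp
  -- A square matrix whose only non-zero row is `a` has Gram matrix `(aᵢ* aⱼ)`.
  · obtain ⟨N', hN'⟩ := h (k + 1) (Matrix.of fun i j => if i = 0 then a j else 0)
    have : ∀ i j, φ (star (a i) * a j) = (N'ᴴ * N') i j := by
      intro i j
      rw [← hN']
      simp [Matrix.mul_apply]
    simp_rw [this]
    exact sum_inner_conjTranspose_mul_nonneg _ _

/-- The Gram matrix `N*N` is the sum, over the rows of `N`, of kernels `aᵢ* aⱼ`. -/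
theorem KernelPositive.sum_nonneg {φ : A →ₗ[ℂ] (K →L[ℂ] K)} (h : KernelPositive φ)
    {m : Type*} [Fintype m] {k : ℕ} (N : Matrix m (Fin k) A) (x : Fin k → K) :
    0 ≤ ∑ i, ∑ j, ⟪x i, φ ((Nᴴ * N) i j) (x j)⟫_ℂ := by
  have : ∑ i, ∑ j, ⟪x i, φ ((Nᴴ * N) i j) (x j)⟫_ℂ =
      ∑ t, ∑ i, ∑ j, ⟪x i, φ (star (N t i) * N t j) (x j)⟫_ℂ := by
    have h2 : ∀ i j, ⟪x i, φ ((Nᴴ * N) i j) (x j)⟫_ℂ =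
        ∑ t, ⟪x i, φ (star (N t i) * N t j) (x j)⟫_ℂ := by
      intro i j
      simp [Matrix.mul_apply, _root_.sum_apply]
    simp_rw [h2]
    exact (Finset.sum_congr rfl fun i _ => Finset.sum_comm).trans Finset.sum_comm
  rw [this]
  exact Finset.sum_nonneg fun t _ => h k (N t) x

theorem KernelPositive.isCompletelyPositive {φ : A →ₗ[ℂ] (K →L[ℂ] K)} (h : KernelPositive φ) :
    IsCompletelyPositive φ := by
  rw [isCompletelyPositive_iff]
  intro k N
  exact exists_eq_conjTranspose_mul _ fun x => h.sum_nonneg N x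

/-- The kernel of the pair `(e, b)` is hermitian, and its off-diagonal entries are `φ b` and `φ
(b*)`. -/
theorem KernelPositive.map_star_of_left_unit {φ : A →ₗ[ℂ] (K →L[ℂ] K)} (h : KernelPositive φ)
    {e : A} (he : ∀ b, star e * b = b) (b : A) : φ (star b) = star (φ b) := by
  have hM := conjTranspose_eq_of_sum_inner_nonneg
    (Matrix.of fun i j => φ (star (![e, b] i) * ![e, b] j)) (fun x => h 2 ![e, b] x)
  have hb : star b * e = star b := by rw [← star_star e, ← star_mul, he]
  have := congrFun (congrFun hM 1) 0
  simp only [Matrix.conjTranspose_apply, Matrix.of_apply, Matrix.cons_val_zero,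
    Matrix.cons_val_one, hb, he] at this
  exact this.symm

end MatrixPositivity

/-! ### From positive families of sesquilinear forms to bounded operators. -/

section Sesquilinear

open scoped ComplexOrder InnerProductSpace
open Matrix

variable {A : Type*} [CStarAlgebra A]
variable {K : Type*} [NormedAddCommGroup K] [InnerProductSpace ℂ K]

theorem exists_norm_sq_sub_eq (a : A) :
    ∃ d : A, ((‖a‖ ^ 2 : ℝ) : ℂ) • (1 : A) - star a * a = star d * d := by
  let _ : PartialOrder A := CStarAlgebra.spectralOrder A
  have _ : StarOrderedRing A := CStarAlgebra.spectralOrderedRing A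
  refine nonneg_iff_exists_star_mul_self.mp (sub_nonneg.mpr ?_)
  have := CStarAlgebra.star_mul_le_algebraMap_norm_sq (a := a)
  rwa [Algebra.algebraMap_eq_smul_one, ← Complex.coe_smul] at this

/-- A Cauchy–Schwarz inequality: the kernel of `(1, a)` is evaluated at `(t z x, y)` with `z = S a x
y` and `t` real. The factor `z` makes the cross terms the real number `2t‖z‖²`, and the discriminant
of the resulting quadratic in `t` is the estimate. -/
theorem norm_le_of_kernel_nonneg (S : A →ₗ[ℂ] K →ₗ⋆[ℂ] K →ₗ[ℂ] ℂ) {M : ℝ} (hM0 : 0 ≤ M)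
    (hS : ∀ (k : ℕ) (a : Fin k → A) (x : Fin k → K),
      0 ≤ ∑ i, ∑ j, S (star (a i) * a j) (x i) (x j))
    (hM : ∀ x, (S 1 x x).re ≤ M * ‖x‖ ^ 2) (a : A) (x y : K) :
    ‖S a x y‖ ≤ M * ‖a‖ * ‖x‖ * ‖y‖ := by
  have hS1 : ∀ (d : A) (y : K), 0 ≤ S (star d * d) y y := by
    intro d y
    simpa using hS 1 (fun _ => d) (fun _ => y)
  have hy : (S (star a * a) y y).re ≤ ‖a‖ ^ 2 * (M * ‖y‖ ^ 2) := by
    obtain ⟨d, hd⟩ := exists_norm_sq_sub_eq a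
    have h := hS1 d y
    rw [← hd] at h
    have h2 : 0 ≤ (((‖a‖ ^ 2 : ℝ) : ℂ) * S 1 y y - S (star a * a) y y).re := by
      simpa using (Complex.nonneg_iff.mp h).1
    rw [Complex.sub_re, Complex.re_ofReal_mul] at h2
    have := mul_le_mul_of_nonneg_left (hM y) (sq_nonneg ‖a‖)
    linarith
  have hconj : S (star a) y x = star (S a x y) := by
    have h1 := hS 2 ![1, a] ![x, y]
    have h2 := hS 2 ![1, a] ![Complex.I • x, y]
    have hx := hS1 1 x
    have ha := hS1 a y
    simp only [Fin.sum_univ_two, Matrix.cons_val_zero, Matrix.cons_val_one, star_one, one_mul,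
      mul_one, map_smulₛₗ, LinearMap.smul_apply, smul_eq_mul, Complex.conj_I] at h1 h2 hx
    rw [Complex.nonneg_iff] at h1 h2 hx ha
    simp only [Complex.add_im, Complex.mul_im, Complex.neg_im, Complex.neg_re, Complex.I_im,
      Complex.I_re, Complex.mul_re, RingHom.id_apply] at h1 h2
    apply Complex.ext
    · simp only [Complex.star_def, Complex.conj_re]
      linarith [h2.2, hx.2, ha.2]
    · simp only [Complex.star_def, Complex.conj_im]
      linarith [h1.2, hx.2, ha.2]
  set z := S a x y with hz
  have hq : ∀ t : ℝ, 0 ≤ (‖z‖ ^ 2 * (M * ‖x‖ ^ 2)) * (t * t) + (2 * ‖z‖ ^ 2) * t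
      + ‖a‖ ^ 2 * (M * ‖y‖ ^ 2) := by
    intro t
    have h1 := hS 2 ![1, a] ![((t : ℂ) * z) • x, y]
    simp only [Fin.sum_univ_two, Matrix.cons_val_zero, Matrix.cons_val_one, star_one, one_mul,
      mul_one, map_smulₛₗ, LinearMap.smul_apply, smul_eq_mul, hconj, ← hz, RingHom.id_apply,
      map_mul, Complex.conj_ofReal] at h1
    have h2 := (Complex.nonneg_iff.mp h1).1
    have e1 : (t : ℂ) * z * ((t : ℂ) * (starRingEnd ℂ) z * S 1 x x) =
        ((t * t * ‖z‖ ^ 2 : ℝ) : ℂ) * S 1 x x := by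
      have := Complex.mul_conj' z
      push_cast
      linear_combination (t : ℂ) * t * S 1 x x * this
    have e2 : (t : ℂ) * (starRingEnd ℂ) z * z = ((t * ‖z‖ ^ 2 : ℝ) : ℂ) := by
      have := Complex.mul_conj' z
      push_cast
      linear_combination (t : ℂ) * this
    have e3 : (t : ℂ) * z * star z = ((t * ‖z‖ ^ 2 : ℝ) : ℂ) := by
      rw [← e2, Complex.star_def]; ring
    rw [e1, e2, e3] at h2
    simp only [Complex.add_re, Complex.re_ofReal_mul, Complex.ofReal_re] at h2
    have := mul_le_mul_of_nonneg_left (hM x) (mul_nonneg (mul_self_nonneg t) (sq_nonneg ‖z‖))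
    nlinarith
  have hd := discrim_le_zero hq
  rw [discrim] at hd
  by_cases hz0 : ‖z‖ = 0
  · rw [hz0]; positivity
  · have hzp : 0 < ‖z‖ ^ 2 := by positivity
    have h3 : ‖z‖ ^ 2 ≤ (M * ‖a‖ * ‖x‖ * ‖y‖) ^ 2 := by
      have : ‖z‖ ^ 2 * ‖z‖ ^ 2 ≤ ‖z‖ ^ 2 * ((M * ‖a‖ * ‖x‖ * ‖y‖) ^ 2) := by nlinarith
      exact le_of_mul_le_mul_left this hzp
    exact (sq_le_sq₀ (norm_nonneg _) (by positivity)).mp h3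

/-- The sesquilinear forms `(x, y) ↦ ⟪x, φ a y⟫`. -/
def formOf (φ : A →ₗ[ℂ] (K →L[ℂ] K)) : A →ₗ[ℂ] K →ₗ⋆[ℂ] K →ₗ[ℂ] ℂ where
  toFun a := LinearMap.mk₂'ₛₗ (starRingEnd ℂ) (RingHom.id ℂ) (fun x y => ⟪x, φ a y⟫_ℂ)
    (fun _ _ _ => inner_add_left _ _ _) (fun _ _ _ => inner_smul_left _ _ _)
    (fun _ _ _ => by rw [map_add, inner_add_right])
    (fun _ _ _ => by rw [map_smul, inner_smul_right]; rfl)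
  map_add' a b := by ext x y; simp
  map_smul' c a := by ext x y; simp

theorem formOf_apply (φ : A →ₗ[ℂ] (K →L[ℂ] K)) (a : A) (x y : K) :
    formOf φ a x y = ⟪x, φ a y⟫_ℂ := rfl

theorem KernelPositive.norm_le {φ : A →ₗ[ℂ] (K →L[ℂ] K)} (h : KernelPositive φ) (a : A) :
    ‖φ a‖ ≤ ‖φ 1‖ * ‖a‖ := by
  refine ContinuousLinearMap.opNorm_le_bound _ (by positivity) fun y => ?_
  have hM : ∀ x, (formOf φ 1 x x).re ≤ ‖φ 1‖ * ‖x‖ ^ 2 := by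
    intro x
    calc (⟪x, φ 1 x⟫_ℂ).re ≤ ‖⟪x, φ 1 x⟫_ℂ‖ := Complex.re_le_norm _
      _ ≤ ‖x‖ * ‖φ 1 x‖ := norm_inner_le_norm _ _
      _ ≤ ‖x‖ * (‖φ 1‖ * ‖x‖) := by gcongr; exact (φ 1).le_opNorm x
      _ = _ := by ring
  have := norm_le_of_kernel_nonneg (formOf φ) (norm_nonneg (φ 1)) h hM a (φ a y) y
  rw [formOf_apply, inner_self_eq_norm_sq_to_K] at this
  simp only [norm_pow, Complex.coe_algebraMap, Complex.norm_real, norm_norm] at this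
  by_cases h0 : ‖φ a y‖ = 0
  · rw [h0]; positivity
  · have hp : 0 < ‖φ a y‖ := by positivity
    refine le_of_mul_le_mul_left ?_ hp
    calc ‖φ a y‖ * ‖φ a y‖ = ‖φ a y‖ ^ 2 := by ring
      _ ≤ _ := this
      _ = _ := by ring

/-- Positivity bounds each form, so the forms are represented by operators. Only the value at the
unit needs an a priori bound. -/
theorem exists_linearMap_of_kernel_nonneg [CompleteSpace K] (S : A →ₗ[ℂ] K →ₗ⋆[ℂ] K →ₗ[ℂ] ℂ)
    {M : ℝ} (hM0 : 0 ≤ M)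
    (hS : ∀ (k : ℕ) (a : Fin k → A) (x : Fin k → K),
      0 ≤ ∑ i, ∑ j, S (star (a i) * a j) (x i) (x j))
    (hM : ∀ x, (S 1 x x).re ≤ M * ‖x‖ ^ 2) :
    ∃ φ : A →ₗ[ℂ] (K →L[ℂ] K), KernelPositive φ ∧ ∀ a x y, ⟪x, φ a y⟫_ℂ = S a x y := by
  have hb := norm_le_of_kernel_nonneg S hM0 hS hM
  let T : A → K →L[ℂ] K := fun a => ContinuousLinearMap.adjoint
    (InnerProductSpace.continuousLinearMapOfBilin
      (LinearMap.mkContinuous₂ (S a) (M * ‖a‖) (hb a)))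
  have hT : ∀ a x y, ⟪x, T a y⟫_ℂ = S a x y := by
    intro a x y
    simp only [T]
    rw [ContinuousLinearMap.adjoint_inner_right,
      InnerProductSpace.continuousLinearMapOfBilin_apply]
    rfl
  refine ⟨⟨⟨T, fun a b => ?_⟩, fun c a => ?_⟩, ?_, hT⟩
  · ext y
    refine ext_inner_left ℂ fun x => ?_
    simp [hT, inner_add_right]
  · ext y
    refine ext_inner_left ℂ fun x => ?_
    simp [hT, inner_smul_right]
  · intro k a x
    have := hS k a x
    simp_rw [← hT] at this
    exact this

end Sesquilinear

/-! ### Arveson's extension theorem by Riesz extension on kernels. -/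

section OperatorSystem

open scoped ComplexOrder InnerProductSpace
open Matrix

variable {A : Type*} [CStarAlgebra A] {I : Type*}

/-- The rank one kernel `(i, j) ↦ cᵢ* cⱼ`. -/
def rankOneKernel (c : I →₀ A) : (I × I) →₀ A :=
  Finsupp.onFinset (c.support ×ˢ c.support) (fun p => star (c p.1) * c p.2) (by
    intro p hp
    rw [Finset.mem_product, Finsupp.mem_support_iff, Finsupp.mem_support_iff]
    exact ⟨fun h => hp (by simp [h]), fun h => hp (by simp [h])⟩)

@[simp]
theorem rankOneKernel_apply (c : I →₀ A) (p : I × I) :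
    rankOneKernel c p = star (c p.1) * c p.2 := rfl

/-- The adjoint kernel `(i, j) ↦ vⱼᵢ*`. -/
def adjointKernel (v : (I × I) →₀ A) : (I × I) →₀ A :=
  Finsupp.equivMapDomain (Equiv.prodComm I I) (v.mapRange star (star_zero A))

@[simp]
theorem adjointKernel_apply (v : (I × I) →₀ A) (p : I × I) :
    adjointKernel v p = star (v p.swap) := rfl

theorem star_single_mul_single (i j k l : I) (a b : A) :
    star (Finsupp.single i a k) * Finsupp.single j b l =
      Finsupp.single (i, j) (star a * b) (k, l) := by
  classical
  by_cases h1 : i = k <;> by_cases h2 : j = l <;> simp [h1, h2]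

theorem star_single_swap (i j k l : I) (a : A) :
    star (Finsupp.single (i, j) a (l, k)) = Finsupp.single (j, i) (star a) (k, l) := by
  classical
  by_cases h1 : i = l <;> by_cases h2 : j = k <;> simp [h1, h2]

/-- The finite sums of rank one kernels. -/
def IsKernelSum (v : (I × I) →₀ A) : Prop :=
  ∃ (m : ℕ) (c : Fin m → I →₀ A), v = ∑ t, rankOneKernel (c t)

theorem IsKernelSum.add {v w : (I × I) →₀ A} (hv : IsKernelSum v) (hw : IsKernelSum w) :
    IsKernelSum (v + w) := by
  obtain ⟨m, c, rfl⟩ := hv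
  obtain ⟨n, d, rfl⟩ := hw
  refine ⟨m + n, Fin.append c d, ?_⟩
  rw [Fin.sum_univ_add]
  simp

theorem isKernelSum_zero : IsKernelSum (0 : (I × I) →₀ A) := ⟨0, Fin.elim0, by simp⟩

theorem isKernelSum_rankOneKernel (c : I →₀ A) : IsKernelSum (rankOneKernel c) :=
  ⟨1, fun _ => c, by simp⟩

theorem IsKernelSum.smul {v : (I × I) →₀ A} (hv : IsKernelSum v) {r : ℝ} (hr : 0 ≤ r) :
    IsKernelSum (r • v) := by
  obtain ⟨m, c, rfl⟩ := hv
  refine ⟨m, fun t => √r • c t, ?_⟩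
  rw [Finset.smul_sum]
  refine Finset.sum_congr rfl fun t _ => ?_
  ext p
  simp [smul_smul, Real.mul_self_sqrt hr]

/-- The kernels whose hermitian part is a finite sum of rank one kernels. -/
def accretiveCone (A I : Type*) [CStarAlgebra A] : PointedCone ℝ ((I × I) →₀ A) where
  carrier := {v | IsKernelSum (v + adjointKernel v)}
  add_mem' := by
    intro v w hv hw
    have : v + w + adjointKernel (v + w) = (v + adjointKernel v) + (w + adjointKernel w) := by
      ext p; simp; abel
    change IsKernelSum _
    rw [this]
    exact IsKernelSum.add hv hw
  zero_mem' := by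
    have : (0 : (I × I) →₀ A) + adjointKernel 0 = 0 := by ext p; simp
    change IsKernelSum _
    rw [this]
    exact isKernelSum_zero
  smul_mem' := by
    rintro ⟨r, hr⟩ v hv
    have : (r • v) + adjointKernel (r • v) = r • (v + adjointKernel v) := by
      ext p; simp
    change IsKernelSum ((r • v) + adjointKernel (r • v))
    rw [this]
    exact IsKernelSum.smul hv hr

theorem mem_accretiveCone {v : (I × I) →₀ A} :
    v ∈ accretiveCone A I ↔ IsKernelSum (v + adjointKernel v) := Iff.rfl

/-- Kernels with entries in a subspace. -/
def entriesIn (W : Submodule ℂ A) (I : Type*) : Submodule ℝ ((I × I) →₀ A) where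
  carrier := {v | ∀ p, v p ∈ W}
  add_mem' := fun hv hw p => W.add_mem (hv p) (hw p)
  zero_mem' := fun _ => W.zero_mem
  smul_mem' := fun r v hv p => by
    have := W.smul_mem (r : ℂ) (hv p)
    simpa using this

/-- The majorization hypothesis of the Riesz theorem. An entry `a` at `(i, j)` is dominated by
scalar entries on the diagonal, since the kernel of `eᵢ + a eⱼ` has diagonal part `1` at `i` and
`a*a ≤ ‖a‖²` at `j`; the defect `d*d` is again a rank one kernel. -/
theorem exists_add_mem_accretiveCone {W : Submodule ℂ A} (h1 : (1 : A) ∈ W)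
    (y : (I × I) →₀ A) : ∃ x : entriesIn W I, (x : (I × I) →₀ A) + y ∈ accretiveCone A I := by
  classical
  induction y using Finsupp.induction_linear with
  | zero => exact ⟨0, by simp⟩
  | add v w hv hw =>
    obtain ⟨x, hx⟩ := hv
    obtain ⟨x', hx'⟩ := hw
    refine ⟨x + x', ?_⟩
    have := (accretiveCone A I).add_mem hx hx'
    rwa [add_add_add_comm] at this
  | single p a =>
    obtain ⟨i, j⟩ := p
    obtain ⟨d, hd⟩ := exists_norm_sq_sub_eq a
    obtain ⟨P, hPW, hP⟩ : ∃ P ∈ W, P + star P = 1 := by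
      refine ⟨(1 / 2 : ℂ) • 1, W.smul_mem _ h1, ?_⟩
      rw [star_smul, star_one, ← add_smul]
      simp
      norm_num
    obtain ⟨Q, hQW, hQ⟩ : ∃ Q ∈ W, Q + star Q = star a * a + star d * d := by
      refine ⟨((‖a‖ ^ 2 / 2 : ℝ) : ℂ) • 1, W.smul_mem _ h1, ?_⟩
      rw [← hd, star_smul, star_one, ← add_smul]
      simp only [Complex.star_def, Complex.conj_ofReal]
      rw [← Complex.ofReal_add, add_halves]
      abel
    refine ⟨⟨Finsupp.single (i, i) P + Finsupp.single (j, j) Q, fun p => ?_⟩, ?_⟩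
    · refine W.add_mem ?_ ?_ <;>
      · rw [Finsupp.single_apply]
        split_ifs
        · assumption
        · exact W.zero_mem
    · rw [mem_accretiveCone]
      have : IsKernelSum (rankOneKernel (Finsupp.single i 1 + Finsupp.single j a)
          + rankOneKernel (Finsupp.single j d)) :=
        (isKernelSum_rankOneKernel _).add (isKernelSum_rankOneKernel _)
      convert this using 1
      ext ⟨k, l⟩
      simp only [Finsupp.add_apply, adjointKernel_apply, Prod.swap_prod_mk, rankOneKernel_apply,
        star_add, star_single_swap, add_mul, mul_add, star_single_mul_single, star_one, mul_one,
        one_mul]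
      have hP' : Finsupp.single (i, i) P (k, l) + Finsupp.single (i, i) (star P) (k, l) =
          Finsupp.single (i, i) 1 (k, l) := by
        rw [← hP, Finsupp.single_add, Finsupp.add_apply]
      have hQ' : Finsupp.single (j, j) Q (k, l) + Finsupp.single (j, j) (star Q) (k, l) =
          Finsupp.single (j, j) (star a * a) (k, l) + Finsupp.single (j, j) (star d * d) (k, l) := by
        rw [← Finsupp.add_apply, ← Finsupp.single_add, hQ, Finsupp.single_add, Finsupp.add_apply]
      linear_combination (norm := abel) hP' + hQ'

variable {K : Type*} [NormedAddCommGroup K] [InnerProductSpace ℂ K]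

/-- The functional on kernels induced by a map into the bounded operators and a basis. -/
def kernelFunctional (h : Module.Basis I ℂ K) (f : A →ₗ[ℂ] (K →L[ℂ] K)) :
    ((I × I) →₀ A) →ₗ[ℂ] ℂ :=
  Finsupp.lsum ℂ fun p =>
    { toFun := fun a => formOf f a (h p.1) (h p.2)
      map_add' := fun a b => by simp
      map_smul' := fun c a => by simp }

theorem kernelFunctional_eq_sum (h : Module.Basis I ℂ K) (f : A →ₗ[ℂ] (K →L[ℂ] K))
    (v : (I × I) →₀ A) (S : Finset I) (hS : ∀ p, v p ≠ 0 → p.1 ∈ S ∧ p.2 ∈ S) :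
    kernelFunctional h f v = ∑ i ∈ S, ∑ j ∈ S, ⟪h i, f (v (i, j)) (h j)⟫_ℂ := by
  have hsub : v.support ⊆ S ×ˢ S := by
    intro p hp
    rw [Finset.mem_product]
    exact hS p (Finsupp.mem_support_iff.mp hp)
  rw [kernelFunctional, Finsupp.lsum_apply, Finsupp.sum_of_support_subset _ hsub _ (by simp),
    Finset.sum_product]
  rfl

theorem exists_finset_support (v : (I × I) →₀ A) :
    ∃ S : Finset I, ∀ p, v p ≠ 0 → p.1 ∈ S ∧ p.2 ∈ S := by
  classical
  refine ⟨v.support.image Prod.fst ∪ v.support.image Prod.snd, fun p hp => ?_⟩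
  have := Finsupp.mem_support_iff.mpr hp
  exact ⟨Finset.mem_union_left _ (Finset.mem_image_of_mem _ this),
    Finset.mem_union_right _ (Finset.mem_image_of_mem _ this)⟩

theorem kernelFunctional_adjointKernel [CompleteSpace K] (h : Module.Basis I ℂ K)
    (f : A →ₗ[ℂ] (K →L[ℂ] K)) (v : (I × I) →₀ A)
    (hf : ∀ p, f (star (v p)) = star (f (v p))) :
    kernelFunctional h f (adjointKernel v) = star (kernelFunctional h f v) := by
  obtain ⟨S, hS⟩ := exists_finset_support v
  rw [kernelFunctional_eq_sum h f v S hS, kernelFunctional_eq_sum h f _ S, star_sum,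
    Finset.sum_comm]
  · refine Finset.sum_congr rfl fun i _ => ?_
    rw [star_sum]
    refine Finset.sum_congr rfl fun j _ => ?_
    rw [adjointKernel_apply, Prod.swap_prod_mk, hf, ContinuousLinearMap.star_eq_adjoint,
      ContinuousLinearMap.adjoint_inner_right, Complex.star_def, inner_conj_symm]
  · intro p hp
    have := hS p.swap (fun h0 => hp (by simp [h0]))
    exact ⟨this.2, this.1⟩

theorem kernelFunctional_nonneg (h : Module.Basis I ℂ K)
    (f : A →ₗ[ℂ] (K →L[ℂ] K)) {W : Submodule ℂ A}
    (hpos : ∀ (k m : ℕ) (N : Matrix (Fin m) (Fin k) A), (∀ i j, (Nᴴ * N) i j ∈ W) →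
      ∀ x : Fin k → K, 0 ≤ ∑ i, ∑ j, ⟪x i, f ((Nᴴ * N) i j) (x j)⟫_ℂ)
    {v : (I × I) →₀ A} (hv : IsKernelSum v) (hW : ∀ p, v p ∈ W) :
    0 ≤ kernelFunctional h f v := by
  obtain ⟨S, hS⟩ := exists_finset_support v
  obtain ⟨m, c, rfl⟩ := hv
  rw [kernelFunctional_eq_sum h f _ S hS]
  set e := S.equivFin
  let N : Matrix (Fin m) (Fin S.card) A := Matrix.of fun t i => c t (e.symm i)
  have hN : ∀ i j, (Nᴴ * N) i j = (∑ t, rankOneKernel (c t)) ((e.symm i : I), (e.symm j : I)) := by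
    intro i j
    simp [N, Matrix.mul_apply, Finsupp.finsetSum_apply]
  have := hpos S.card m N (fun i j => by rw [hN]; exact hW _) fun i => h (e.symm i)
  simp_rw [hN] at this
  rw [← Finset.sum_coe_sort S, ← Equiv.sum_comp e.symm]
  simp_rw [← Finset.sum_coe_sort S]
  refine this.trans_eq (Finset.sum_congr rfl fun i _ => ?_)
  rw [← Equiv.sum_comp e.symm]

/-- The kernel `(i, j) ↦ x̄ᵢ yⱼ a`, where `xᵢ` and `yⱼ` are coordinates in a basis. -/
def tensorKernel (h : Module.Basis I ℂ K) (a : A) (x y : K) : (I × I) →₀ A :=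
  Finsupp.onFinset ((h.repr x).support ×ˢ (h.repr y).support)
    (fun p => (star (h.repr x p.1) * h.repr y p.2) • a) (by
    intro p hp
    rw [Finset.mem_product, Finsupp.mem_support_iff, Finsupp.mem_support_iff]
    exact ⟨fun h => hp (by simp [h]), fun h => hp (by simp [h])⟩)

@[simp]
theorem tensorKernel_apply (h : Module.Basis I ℂ K) (a : A) (x y : K) (p : I × I) :
    tensorKernel h a x y p = (star (h.repr x p.1) * h.repr y p.2) • a := rfl

theorem kernelFunctional_tensorKernel (h : Module.Basis I ℂ K) (f : A →ₗ[ℂ] (K →L[ℂ] K))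
    (a : A) (x y : K) : kernelFunctional h f (tensorKernel h a x y) = ⟪x, f a y⟫_ℂ := by
  classical
  rw [kernelFunctional_eq_sum h f _ ((h.repr x).support ∪ (h.repr y).support)]
  · have hx : x = ∑ i ∈ (h.repr x).support ∪ (h.repr y).support, h.repr x i • h i := by
      conv_lhs => rw [← h.linearCombination_repr x, Finsupp.linearCombination_apply]
      exact Finsupp.sum_of_support_subset _ Finset.subset_union_left _ (by simp)
    have hy : y = ∑ i ∈ (h.repr x).support ∪ (h.repr y).support, h.repr y i • h i := by
      conv_lhs => rw [← h.linearCombination_repr y, Finsupp.linearCombination_apply]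
      exact Finsupp.sum_of_support_subset _ Finset.subset_union_right _ (by simp)
    generalize (h.repr x).support ∪ (h.repr y).support = S at hx hy
    conv_rhs => rw [hx, hy, map_sum, sum_inner]
    refine Finset.sum_congr rfl fun i _ => ?_
    rw [inner_sum]
    refine Finset.sum_congr rfl fun j _ => ?_
    simp only [tensorKernel_apply, map_smul, _root_.smul_apply, inner_smul_left, inner_smul_right]
    rw [Complex.star_def]
    ring
  · intro p hp
    refine ⟨Finset.mem_union_left _ (Finsupp.mem_support_iff.mpr fun h0 => hp (by simp [h0])),
      Finset.mem_union_right _ (Finsupp.mem_support_iff.mpr fun h0 => hp (by simp [h0]))⟩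

/-- This identity turns positivity of a functional on rank one kernels into positivity of the forms
it defines. -/
theorem sum_tensorKernel (h : Module.Basis I ℂ K) {k : ℕ} (a : Fin k → A) (x : Fin k → K) :
    ∑ i, ∑ j, tensorKernel h (star (a i) * a j) (x i) (x j) =
      rankOneKernel (∑ i, (h.repr (x i)).mapRange (fun s => s • a i) (zero_smul ℂ _)) := by
  ext p
  simp only [Finsupp.finsetSum_apply, tensorKernel_apply, rankOneKernel_apply,
    Finsupp.mapRange_apply, star_sum, star_smul, Finset.sum_mul_sum, smul_mul_smul_comm]

/-- **Arveson's extension theorem** for maps on an operator system. -/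
theorem exists_kernelPositive_extension [CompleteSpace K] (W : Submodule ℂ A)
    (hstar : ∀ w ∈ W, star w ∈ W) (h1 : (1 : A) ∈ W) (f : A →ₗ[ℂ] (K →L[ℂ] K))
    (hf : ∀ w ∈ W, f (star w) = star (f w))
    (hpos : ∀ (k m : ℕ) (N : Matrix (Fin m) (Fin k) A), (∀ i j, (Nᴴ * N) i j ∈ W) →
      ∀ x : Fin k → K, 0 ≤ ∑ i, ∑ j, ⟪x i, f ((Nᴴ * N) i j) (x j)⟫_ℂ) :
    ∃ g : A →ₗ[ℂ] (K →L[ℂ] K), KernelPositive g ∧ ∀ w ∈ W, g w = f w := by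
  let h := Module.Basis.ofVectorSpace ℂ K
  set I := Module.Basis.ofVectorSpaceIndex ℂ K
  let p : ((I × I) →₀ A) →ₗ.[ℝ] ℝ :=
    { domain := entriesIn W I
      toFun := (Complex.reLm ∘ₗ (kernelFunctional h f).restrictScalars ℝ) ∘ₗ
        (entriesIn W I).subtype }
  have hp : ∀ v : p.domain, p v = (kernelFunctional h f v).re := fun v => rfl
  -- On the kernels with entries in `W`, twice the real part of the functional at `v` is its value
  -- at `v + v*`, which is nonnegative when `v` lies in the cone.
  obtain ⟨g, hgp, hgs⟩ := riesz_extension (accretiveCone A I) p (by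
    rintro ⟨v, hv⟩ hvs
    have hv' : ∀ p, v p ∈ W := hv
    have h2 := kernelFunctional_nonneg h f hpos (mem_accretiveCone.mp hvs) (fun p => by
      rw [Finsupp.add_apply]
      exact W.add_mem (hv' _) (hstar _ (hv' _)))
    rw [map_add, kernelFunctional_adjointKernel h f v fun p => hf _ (hv' p)] at h2
    have h3 := (Complex.nonneg_iff.mp h2).1
    simp only [Complex.add_re, Complex.star_def, Complex.conj_re] at h3
    rw [hp]
    linarith) (exists_add_mem_accretiveCone h1)
  -- The complex-linear functional with real part `g`.
  let G : ((I × I) →₀ A) →ₗ[ℂ] ℂ :=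
    { toFun := fun v => (g v : ℂ) - Complex.I * (g (Complex.I • v) : ℂ)
      map_add' := fun v w => by
        simp only [smul_add, map_add]; push_cast; ring
      map_smul' := fun c v => by
        have e1 : c • v = c.re • v + c.im • (Complex.I • v) := by
          ext q
          simp only [Finsupp.smul_apply, Finsupp.add_apply]
          conv_lhs => rw [← Complex.re_add_im c]
          rw [add_smul, mul_smul, Complex.coe_smul, Complex.coe_smul]
        have e2 : Complex.I • c • v = c.re • (Complex.I • v) - c.im • v := by
          ext q
          simp only [Finsupp.smul_apply, Finsupp.sub_apply]
          conv_lhs => rw [← Complex.re_add_im c]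
          rw [add_smul, smul_add, mul_smul, smul_comm _ (c.im : ℂ), smul_smul Complex.I Complex.I,
            Complex.I_mul_I, Complex.coe_smul, Complex.coe_smul, neg_one_smul, smul_neg,
            smul_comm, ← sub_eq_add_neg]
        rw [e2, e1]
        simp only [map_add, map_sub, map_smul, smul_eq_mul, RingHom.id_apply]
        conv_rhs => rw [← Complex.re_add_im c]
        push_cast
        linear_combination (c.im : ℂ) * (g (Complex.I • v)) * Complex.I_sq }
  have hGW : ∀ v, (∀ p, v p ∈ W) → G v = kernelFunctional h f v := by
    intro v hv
    have h1 := hgp ⟨v, hv⟩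
    have h2 := hgp ⟨Complex.I • v, fun p => W.smul_mem _ (hv p)⟩
    rw [hp] at h1 h2
    simp only at h1 h2
    change (g v : ℂ) - Complex.I * (g (Complex.I • v) : ℂ) = _
    rw [h1, h2, map_smul]
    apply Complex.ext <;> simp
  have hGc : ∀ c : I →₀ A, 0 ≤ G (rankOneKernel c) := by
    intro c
    have had : adjointKernel (rankOneKernel c) = rankOneKernel c := by
      ext p; simp
    have h1 : 0 ≤ g (rankOneKernel c) := hgs _ (by
      rw [mem_accretiveCone, had]
      exact (isKernelSum_rankOneKernel c).add (isKernelSum_rankOneKernel c))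
    -- Skew-hermitian kernels lie in the cone together with their negatives, so `g` vanishes on them
    -- and `G` is real on rank one kernels.
    have h2 : 0 ≤ g (Complex.I • rankOneKernel c) := hgs _ (by
      rw [mem_accretiveCone]
      convert isKernelSum_zero using 1
      ext p; simp)
    have h3 : 0 ≤ g (-(Complex.I • rankOneKernel c)) := hgs _ (by
      rw [mem_accretiveCone]
      convert isKernelSum_zero using 1
      ext p; simp)
    rw [map_neg] at h3
    have h4 : g (Complex.I • rankOneKernel c) = 0 := by linarith
    change (0 : ℂ) ≤ (g (rankOneKernel c) : ℂ) - Complex.I * (g (Complex.I • rankOneKernel c) : ℂ)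
    rw [h4]
    simpa using h1
  let S : A →ₗ[ℂ] K →ₗ⋆[ℂ] K →ₗ[ℂ] ℂ :=
    { toFun := fun a => LinearMap.mk₂'ₛₗ (starRingEnd ℂ) (RingHom.id ℂ)
        (fun x y => G (tensorKernel h a x y))
        (fun x x' y => by
          rw [← map_add]; congr 1; ext p; simp [add_mul, add_smul])
        (fun c x y => by
          rw [← map_smul]; congr 1; ext p; simp [smul_smul, mul_assoc])
        (fun x y y' => by
          rw [← map_add]; congr 1; ext p; simp [mul_add, add_smul])
        (fun c x y => by
          rw [← map_smul]; congr 1; ext p; simp [smul_smul, mul_left_comm])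
      map_add' := fun a b => by
        ext x y
        simp only [LinearMap.mk₂'ₛₗ_apply, LinearMap.add_apply]
        rw [← map_add]; congr 1; ext p; simp
      map_smul' := fun c a => by
        ext x y
        simp only [LinearMap.mk₂'ₛₗ_apply, LinearMap.smul_apply, RingHom.id_apply]
        rw [← map_smul]; congr 1; ext p; simp [smul_comm c] }
  have hSG : ∀ a x y, S a x y = G (tensorKernel h a x y) := fun _ _ _ => rfl
  have hSW : ∀ w ∈ W, ∀ x y, S w x y = ⟪x, f w y⟫_ℂ := by
    intro w hw x y
    rw [hSG, hGW _ fun p => W.smul_mem _ hw, kernelFunctional_tensorKernel]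
  obtain ⟨φ, hφ, hφS⟩ := exists_linearMap_of_kernel_nonneg S (norm_nonneg (f 1)) (by
    intro k a x
    simp_rw [hSG, ← map_sum, sum_tensorKernel]
    exact hGc _) (by
    intro x
    rw [hSW 1 h1]
    calc (⟪x, f 1 x⟫_ℂ).re ≤ ‖⟪x, f 1 x⟫_ℂ‖ := Complex.re_le_norm _
      _ ≤ ‖x‖ * ‖f 1 x‖ := norm_inner_le_norm _ _
      _ ≤ ‖x‖ * (‖f 1‖ * ‖x‖) := by gcongr; exact (f 1).le_opNorm x
      _ = _ := by ring)
  refine ⟨φ, hφ, fun w hw => ?_⟩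
  ext y
  refine ext_inner_left ℂ fun x => ?_
  rw [hφS, hSW w hw]

end OperatorSystem

/-! ### Contractive extensions from subalgebras, with control of the unit. -/

section Extension

open scoped ComplexOrder InnerProductSpace Topology
open Matrix

/-- Conjugating `σ a` by the image of the negative part `c` gives `-σ (c³) ≥ 0`, while `σ (c³) ≥ 0`.
Injectivity then gives `c = 0`. -/
theorem nonneg_of_map_nonneg {C D : Type*} [NonUnitalCStarAlgebra C] [NonUnitalCStarAlgebra D]
    [PartialOrder C] [StarOrderedRing C] [PartialOrder D] [StarOrderedRing D]
    (σ : C →⋆ₙₐ[ℂ] D) (hσ : Function.Injective σ) {a : C} (ha : 0 ≤ σ a) : 0 ≤ a := by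
  have hsa : IsSelfAdjoint a := hσ (by rw [map_star, (IsSelfAdjoint.of_nonneg ha).star_eq])
  obtain ⟨c, hc, hac, hc0⟩ := exists_negPart hsa
  refine hc0 ?_
  have hcs : star c = c := (IsSelfAdjoint.of_nonneg hc).star_eq
  have h3 : 0 ≤ c * c * c := by
    have := star_left_conjugate_nonneg hc c
    rwa [hcs] at this
  have h4 : 0 ≤ -σ (c * c * c) := by
    have := star_left_conjugate_nonneg ha (σ c)
    rw [← map_star, hcs, ← map_mul, ← map_mul, mul_assoc, hac] at this
    rwa [← map_neg, mul_assoc, ← mul_neg]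
  have h5 : 0 ≤ σ (c * c * c) := by
    obtain ⟨d, hd⟩ := nonneg_iff_exists_star_mul_self.mp h3
    rw [hd, map_mul, map_star]
    exact star_mul_self_nonneg _
  have h6 : c * c * c = 0 := hσ (by rw [map_zero]; exact le_antisymm (neg_nonneg.mp h4) h5)
  have h7 : c * c = 0 := by
    rw [← CStarRing.star_mul_self_eq_zero_iff, star_mul, hcs, ← mul_assoc, h6, zero_mul]
  rwa [← CStarRing.star_mul_self_eq_zero_iff, hcs]

/-- A rectangular matrix is split into rows, each one placed as the first row of a square matrix. -/
theorem ofMatrix_conjTranspose_mul_nonneg {A : Type*} [NonUnitalCStarAlgebra A]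
    [PartialOrder A] [StarOrderedRing A] {m k : ℕ} (N : Matrix (Fin m) (Fin k) A) :
    0 ≤ CStarMatrix.ofMatrix (Nᴴ * N) := by
  rcases k with _ | k
  · exact (CStarMatrix.ext fun i => i.elim0 :
      (0 : CStarMatrix (Fin 0) (Fin 0) A) = CStarMatrix.ofMatrix (Nᴴ * N)).le
  · let R : Fin m → CStarMatrix (Fin (k + 1)) (Fin (k + 1)) A := fun t =>
      CStarMatrix.ofMatrix (Matrix.of fun i j => if i = 0 then N t j else 0)
    have : CStarMatrix.ofMatrix (Nᴴ * N) = ∑ t, star (R t) * R t := by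
      have h1 : ∀ t, star (R t) * R t =
          CStarMatrix.ofMatrix (Matrix.of fun i j => star (N t i) * N t j) := by
        intro t
        refine CStarMatrix.ext fun i j => ?_
        rw [CStarMatrix.mul_apply]
        simp [R, CStarMatrix.star_apply]
      simp_rw [h1]
      have h2 : Nᴴ * N = ∑ t, Matrix.of fun i j => star (N t i) * N t j := by
        ext i j
        simp [Matrix.mul_apply, Matrix.sum_apply]
      rw [h2]
      exact map_sum (CStarMatrix.ofMatrixₗ (R := ℂ)) _ _
    rw [this]
    exact Finset.sum_nonneg fun t _ => star_mul_self_nonneg _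

theorem exists_conjTranspose_mul_of_map {A B : Type*} [NonUnitalCStarAlgebra A]
    [NonUnitalCStarAlgebra B] (ι : B →⋆ₙₐ[ℂ] A) (hι : Function.Injective ι) {m k : ℕ}
    (N : Matrix (Fin m) (Fin k) A) (β : Matrix (Fin k) (Fin k) B) (h : β.map ι = Nᴴ * N) :
    ∃ N' : Matrix (Fin k) (Fin k) B, β = N'ᴴ * N' := by
  let _ : PartialOrder A := CStarAlgebra.spectralOrder A
  have _ : StarOrderedRing A := CStarAlgebra.spectralOrderedRing A
  let _ : PartialOrder B := CStarAlgebra.spectralOrder B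
  have _ : StarOrderedRing B := CStarAlgebra.spectralOrderedRing B
  have h0 := ofMatrix_conjTranspose_mul_nonneg N
  rw [← h] at h0
  have h1 : 0 ≤ CStarMatrix.ofMatrix β :=
    nonneg_of_map_nonneg (CStarMatrix.mapₙₐ (n := Fin k) ι)
      (CStarMatrix.map_injective hι) h0
  obtain ⟨N', hN'⟩ := nonneg_iff_exists_star_mul_self.mp h1
  exact ⟨CStarMatrix.ofMatrix.symm N', hN'⟩

variable {A B : Type*} [CStarAlgebra A] [NonUnitalCStarAlgebra B]
variable {K : Type*} [NormedAddCommGroup K] [InnerProductSpace ℂ K] [CompleteSpace K]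

/-- The range of `ι` is an operator system. A Gram matrix over `A` with entries in it comes from a
Gram matrix over `B`, because an injective `*`-homomorphism reflects positivity of matrices. -/
theorem exists_extension_of_map_eq_one (ι : B →⋆ₙₐ[ℂ] A) (hι : Function.Injective ι) {e : B}
    (he : ι e = 1) (φ : B →ₗ[ℂ] (K →L[ℂ] K)) (hφ : KernelPositive φ) :
    ∃ Φ : A →ₗ[ℂ] (K →L[ℂ] K), KernelPositive Φ ∧ ∀ b, Φ (ι b) = φ b := by
  have hstar := hφ.map_star_of_left_unit (e := e)
    fun b => hι (by rw [map_mul, map_star, he, star_one, one_mul])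
  obtain ⟨l, hl⟩ := LinearMap.exists_leftInverse_of_injective (homLin ι)
    (LinearMap.ker_eq_bot.mpr hι)
  have hl' : ∀ b, l (ι b) = b := fun b => LinearMap.congr_fun hl b
  obtain ⟨Φ, hΦ, hΦφ⟩ := exists_kernelPositive_extension (LinearMap.range (homLin ι))
    (by rintro _ ⟨b, rfl⟩; exact ⟨star b, map_star ι b⟩) ⟨e, he⟩ (φ ∘ₗ l)
    (by
      rintro _ ⟨b, rfl⟩
      change φ (l (star (ι b))) = star (φ (l (ι b)))
      rw [← map_star, hl', hl', hstar])
    (by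
      intro k m N hN x
      choose β hβ using hN
      obtain ⟨N', hN'⟩ := exists_conjTranspose_mul_of_map ι hι N (Matrix.of β)
        (by ext i j; exact hβ i j)
      have := hφ.sum_nonneg N' x
      rw [← hN'] at this
      simp_rw [← hβ]
      change 0 ≤ ∑ i, ∑ j, ⟪x i, φ (l (ι (β i j))) (x j)⟫_ℂ
      simp_rw [hl']
      exact this)
  refine ⟨Φ, hΦ, fun b => ?_⟩
  refine (hΦφ _ ⟨b, rfl⟩).trans ?_
  change φ (l (ι b)) = φ b
  rw [hl']

/-- The unital extension of a map to the unitization. -/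
def unitizationMap (φ : B →ₗ[ℂ] (K →L[ℂ] K)) : Unitization ℂ B →ₗ[ℂ] (K →L[ℂ] K) where
  toFun n := n.fst • 1 + φ n.snd
  map_add' m n := by simp only [Unitization.fst_add, Unitization.snd_add, map_add, add_smul]; abel
  map_smul' c n := by
    simp only [Unitization.fst_smul, Unitization.snd_smul, map_smul, smul_add, smul_eq_mul,
      mul_smul, RingHom.id_apply]

theorem inner_map_star_mul_self_le {φ : B →ₗ[ℂ] (K →L[ℂ] K)} (hφ : KernelPositive φ)
    (hc : ∀ b, ‖φ b‖ ≤ ‖b‖) {e : B} (he : ‖e‖ ≤ 1) (y : K) :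
    ⟪y, φ (star e * e) y⟫_ℂ ≤ ((‖y‖ ^ 2 : ℝ) : ℂ) := by
  have h0 : 0 ≤ ⟪y, φ (star e * e) y⟫_ℂ := by simpa using hφ 1 (fun _ => e) fun _ => y
  have h1 : ‖⟪y, φ (star e * e) y⟫_ℂ‖ ≤ ‖y‖ ^ 2 := by
    calc ‖⟪y, φ (star e * e) y⟫_ℂ‖ ≤ ‖y‖ * ‖φ (star e * e) y‖ := norm_inner_le_norm _ _
      _ ≤ ‖y‖ * (1 * ‖y‖) := by
        gcongr
        refine (φ (star e * e)).le_of_opNorm_le ((hc _).trans ?_) y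
        rw [CStarRing.norm_star_mul_self]
        exact mul_le_one₀ he (norm_nonneg _) he
      _ = _ := by ring
  rw [Complex.le_def]
  rw [Complex.nonneg_iff] at h0
  exact ⟨(Complex.re_le_norm _).trans h1, by rw [← h0.2, Complex.ofReal_im]⟩

/-- For an approximate unit `e` the elements `nᵢ e` lie in `B`, so their kernel is positive under
`φ`. Its scalar part is `⟪y, φ (e*e) y⟫`, at most `‖y‖²` by contractivity, and its remaining part
converges to the one wanted as `e` runs along the approximate unit. -/
theorem kernelPositive_unitizationMap {φ : B →ₗ[ℂ] (K →L[ℂ] K)} (hφ : KernelPositive φ)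
    (hc : ∀ b, ‖φ b‖ ≤ ‖b‖) : KernelPositive (unitizationMap φ) := by
  intro k n x
  let _ : PartialOrder B := CStarAlgebra.spectralOrder B
  have _ : StarOrderedRing B := CStarAlgebra.spectralOrderedRing B
  set y : K := ∑ j, (n j).fst • x j with hy
  set d : Fin k → Fin k → B := fun i j => (star (n i) * n j).snd with hd
  have hyy : ∀ T : K →L[ℂ] K, ∑ i, ∑ j, ⟪x i, (star (n i).fst * (n j).fst) • T (x j)⟫_ℂ
      = ⟪y, T y⟫_ℂ := by
    intro T
    rw [hy, map_sum, sum_inner]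
    refine Finset.sum_congr rfl fun i _ => ?_
    rw [inner_sum]
    refine Finset.sum_congr rfl fun j _ => ?_
    rw [map_smul, inner_smul_left, inner_smul_right, inner_smul_right]
    rw [Complex.star_def]; ring
  have hgoal : ∑ i, ∑ j, ⟪x i, unitizationMap φ (star (n i) * n j) (x j)⟫_ℂ =
      ∑ i, ∑ j, ⟪x i, φ (d i j) (x j)⟫_ℂ + ((‖y‖ ^ 2 : ℝ) : ℂ) := by
    have h1 := hyy 1
    rw [one_apply_eq_self, inner_self_eq_norm_sq_to_K] at h1
    push_cast
    simp only [Complex.coe_algebraMap] at h1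
    rw [← h1, ← Finset.sum_add_distrib]
    refine Finset.sum_congr rfl fun i _ => ?_
    rw [← Finset.sum_add_distrib]
    refine Finset.sum_congr rfl fun j _ => ?_
    rw [← inner_add_right, add_comm]
    rfl
  rw [hgoal]
  have hl := CStarAlgebra.increasingApproximateUnit B
  have hne := hl.neBot
  have hbound : ∀ᶠ e in CStarAlgebra.approximateUnit B,
      0 ≤ ∑ i, ∑ j, ⟪x i, φ (e * (d i j * e)) (x j)⟫_ℂ + ((‖y‖ ^ 2 : ℝ) : ℂ) := by
    filter_upwards [hl.eventually_norm, hl.eventually_star_eq] with e he hes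
    have h1 := hφ k (fun i => (n i).fst • e + (n i).snd * e) x
    have h2 : ∀ i j, star ((n i).fst • e + (n i).snd * e) * ((n j).fst • e + (n j).snd * e) =
        e * (d i j * e) + (star (n i).fst * (n j).fst) • (star e * e) := by
      intro i j
      simp only [hd, Unitization.snd_mul, Unitization.fst_star, Unitization.snd_star, star_add,
        star_smul, star_mul, hes, add_mul, mul_add, smul_mul_assoc, mul_smul_comm, mul_assoc,
        smul_add]
      module
    simp_rw [h2, map_add, map_smul, _root_.add_apply, _root_.smul_apply, inner_add_right,
      Finset.sum_add_distrib] at h1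
    rw [hyy] at h1
    exact h1.trans (add_le_add_right (inner_map_star_mul_self_le hφ hc he y) _)
  have hlim : Tendsto (fun e => ∑ i, ∑ j, ⟪x i, φ (e * (d i j * e)) (x j)⟫_ℂ
      + ((‖y‖ ^ 2 : ℝ) : ℂ)) (CStarAlgebra.approximateUnit B)
      (𝓝 (∑ i, ∑ j, ⟪x i, φ (d i j) (x j)⟫_ℂ + ((‖y‖ ^ 2 : ℝ) : ℂ))) := by
    refine Tendsto.add_const _ (tendsto_finsetSum _ fun i _ => tendsto_finsetSum _ fun j _ => ?_)
    have hcont : Continuous fun b => ⟪x i, φ b (x j)⟫_ℂ := by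
      have : Continuous φ := (φ.mkContinuous 1 (by simpa using hc)).continuous
      fun_prop
    refine (hcont.tendsto _).comp ?_
    rw [tendsto_iff_norm_sub_tendsto_zero]
    have hL := tendsto_iff_norm_sub_tendsto_zero.mp (hl.tendsto_mul_left (d i j))
    have hR := tendsto_iff_norm_sub_tendsto_zero.mp (hl.tendsto_mul_right (d i j))
    have hLR := hL.add hR
    rw [add_zero] at hLR
    refine squeeze_zero' (Eventually.of_forall fun _ => norm_nonneg _) ?_ hLR
    filter_upwards [hl.eventually_norm] with e he
    calc ‖e * (d i j * e) - d i j‖ = ‖e * (d i j * e - d i j) + (e * d i j - d i j)‖ := by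
          congr 1; rw [mul_sub]; abel
      _ ≤ ‖e * (d i j * e - d i j)‖ + ‖e * d i j - d i j‖ := norm_add_le _ _
      _ ≤ 1 * ‖d i j * e - d i j‖ + ‖e * d i j - d i j‖ := by
          gcongr
          exact (norm_mul_le _ _).trans (by gcongr)
      _ = _ := by rw [one_mul]
  exact ge_of_tendsto hlim hbound

theorem unitizationMap_one (φ : B →ₗ[ℂ] (K →L[ℂ] K)) : unitizationMap φ 1 = 1 := by
  simp [unitizationMap]

theorem unitizationMap_inr (φ : B →ₗ[ℂ] (K →L[ℂ] K)) (b : B) :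
    unitizationMap φ (b : Unitization ℂ B) = φ b := by
  simp [unitizationMap]

theorem norm_one_le_one (A : Type*) [CStarAlgebra A] : ‖(1 : A)‖ ≤ 1 := by
  rcases subsingleton_or_nontrivial A with h | h
  · rw [Subsingleton.elim (1 : A) 0, norm_zero]; exact zero_le_one
  · rw [CStarRing.norm_one]

/-- **Arveson's extension theorem** for contractive completely positive maps on a C*-subalgebra,
with a unital extension if the subalgebra does not contain the unit. -/
theorem exists_contractive_extension (ι : B →⋆ₙₐ[ℂ] A) (hι : Function.Injective ι)
    (φ : B →ₗ[ℂ] (K →L[ℂ] K)) (hφ : KernelPositive φ) (hc : ∀ b, ‖φ b‖ ≤ ‖b‖) :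
    ∃ Φ : A →ₗ[ℂ] (K →L[ℂ] K), KernelPositive Φ ∧ (∀ a, ‖Φ a‖ ≤ ‖a‖) ∧ (∀ b, Φ (ι b) = φ b) ∧
      ((1 : A) ∉ Set.range ι → Φ 1 = 1) := by
  have hcontr : ∀ Φ : A →ₗ[ℂ] (K →L[ℂ] K), KernelPositive Φ → ‖Φ 1‖ ≤ 1 → ∀ a, ‖Φ a‖ ≤ ‖a‖ :=
    fun Φ hΦ h1 a => (hΦ.norm_le a).trans (by
      simpa using mul_le_mul_of_nonneg_right h1 (norm_nonneg a))
  by_cases h1 : (1 : A) ∈ Set.range ι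
  · obtain ⟨e, he⟩ := h1
    obtain ⟨Φ, hΦ, hΦφ⟩ := exists_extension_of_map_eq_one ι hι he φ hφ
    refine ⟨Φ, hΦ, hcontr Φ hΦ ?_, hΦφ, fun h => absurd ⟨e, he⟩ h⟩
    rw [← he, hΦφ]
    refine (hc e).trans ?_
    rw [← NonUnitalStarAlgHom.norm_map ι hι, he]
    exact norm_one_le_one A
  · have hlift : ∀ n, Unitization.starLift ι n = algebraMap ℂ A n.fst + ι n.snd := fun n => rfl
    -- The unitization embeds in `A`: a relation `λ1 + ι b = 0` with `λ ≠ 0` would put the unit in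
    -- the range.
    have hinj : Function.Injective (Unitization.starLift ι) := by
      rw [injective_iff_map_eq_zero]
      intro n hn
      have hn' : algebraMap ℂ A n.fst + ι n.snd = 0 := by
        rw [← hlift, hn]
      have h0 : n.fst = 0 := by
        by_contra h0
        refine h1 ⟨-(n.fst⁻¹ • n.snd), ?_⟩
        rw [Algebra.algebraMap_eq_smul_one] at hn'
        rw [map_neg, map_smul, eq_neg_of_add_eq_zero_right hn',
          smul_neg, neg_neg, smul_smul, inv_mul_cancel₀ h0, one_smul]
      rw [h0, map_zero, zero_add] at hn'
      have h2 : n.snd = 0 := hι (by rw [hn', map_zero])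
      exact Unitization.ext h0 h2
    obtain ⟨Φ, hΦ, hΦφ⟩ := exists_extension_of_map_eq_one
      ((Unitization.starLift ι : Unitization ℂ B →⋆ₐ[ℂ] A) : Unitization ℂ B →⋆ₙₐ[ℂ] A) hinj
      (map_one (Unitization.starLift ι)) (unitizationMap φ) (kernelPositive_unitizationMap hφ hc)
    have hone : Φ 1 = 1 := by
      rw [← unitizationMap_one φ, ← hΦφ]
      exact congrArg Φ (map_one (Unitization.starLift ι)).symm
    refine ⟨Φ, hΦ, hcontr Φ hΦ ?_, fun b => ?_, fun _ => hone⟩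
    · rw [hone]
      exact norm_one_le_one _
    · rw [← unitizationMap_inr φ, ← hΦφ]
      congr 1
      refine (?_ : ι b = Unitization.starLift ι (b : Unitization ℂ B))
      rw [hlift, Unitization.fst_inr, Unitization.snd_inr, map_zero, zero_add]

end Extension

/-! ### Rank and dimension of finite-dimensional C*-algebras. -/

section FiniteDimensional

open scoped ComplexOrder InnerProductSpace Topology ComplexStarModule

theorem fdRank_bddAbove (F : Type u) [CStarAlgebra F] [FiniteDimensional ℂ F] :
    BddAbove {d : ℕ | ∃ C : StarSubalgebra ℂ F,
      (∀ x ∈ C, ∀ y ∈ C, x * y = y * x) ∧ Module.finrank ℂ C = d} := by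
  refine ⟨Module.finrank ℂ F, ?_⟩
  rintro d ⟨C, -, rfl⟩
  exact Submodule.finrank_le (Subalgebra.toSubmodule C.toSubalgebra)

theorem fdRank_le_finrank (F : Type u) [CStarAlgebra F] [FiniteDimensional ℂ F] :
    fdRank F ≤ Module.finrank ℂ F := by
  refine csSup_le' ?_
  rintro d ⟨C, -, rfl⟩
  exact Submodule.finrank_le (Subalgebra.toSubmodule C.toSubalgebra)

theorem finrank_le_fdRank {F : Type u} [CStarAlgebra F] [FiniteDimensional ℂ F]
    (C : StarSubalgebra ℂ F) (hC : ∀ x ∈ C, ∀ y ∈ C, x * y = y * x) :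
    Module.finrank ℂ C ≤ fdRank F :=
  le_csSup (fdRank_bddAbove F) ⟨C, hC, rfl⟩

variable {F : Type*} [CStarAlgebra F]

/-- A family of nonzero, mutually orthogonal projections. -/
structure IsOrthogonalProjections {k : ℕ} (p : Fin k → F) : Prop where
  ne_zero : ∀ i, p i ≠ 0
  star_eq : ∀ i, star (p i) = p i
  mul_self : ∀ i, p i * p i = p i
  mul_eq_zero : ∀ i j, i ≠ j → p i * p j = 0

theorem IsOrthogonalProjections.cons {k : ℕ} {p : Fin k → F} (hp : IsOrthogonalProjections p)
    {r : F} (h0 : r ≠ 0) (hs : star r = r) (hm : r * r = r) (ho : ∀ i, r * p i = 0) :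
    IsOrthogonalProjections (Fin.cons r p : Fin (k + 1) → F) := by
  have ho' : ∀ i, p i * r = 0 := fun i => by
    rw [← star_eq_zero, star_mul, hs, hp.star_eq, ho]
  refine ⟨fun i => ?_, fun i => ?_, fun i => ?_, fun i j => ?_⟩
  · refine Fin.cases ?_ (fun i => ?_) i
    · simpa using h0
    · simpa using hp.ne_zero i
  · refine Fin.cases ?_ (fun i => ?_) i
    · simpa using hs
    · simpa using hp.star_eq i
  · refine Fin.cases ?_ (fun i => ?_) i
    · simpa using hm
    · simpa using hp.mul_self i
  · refine Fin.cases ?_ (fun i => ?_) i <;> refine Fin.cases ?_ (fun j => ?_) j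
    · simp
    · intro _; simpa using ho j
    · intro _; simpa using ho' i
    · intro h; simpa using hp.mul_eq_zero i j (fun h' => h (by rw [h']))

theorem IsOrthogonalProjections.mul_sum {k : ℕ} {p : Fin k → F} (hp : IsOrthogonalProjections p)
    (c : Fin k → ℂ) (j : Fin k) : p j * ∑ i, c i • p i = c j • p j := by
  rw [Finset.mul_sum, Finset.sum_eq_single j]
  · rw [mul_smul_comm, hp.mul_self]
  · intro i _ hij
    rw [mul_smul_comm, hp.mul_eq_zero j i hij.symm, smul_zero]
  · simp

theorem IsOrthogonalProjections.linearIndependent {k : ℕ} {p : Fin k → F}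
    (hp : IsOrthogonalProjections p) : LinearIndependent ℂ p := by
  rw [Fintype.linearIndependent_iff]
  intro c hc j
  have := hp.mul_sum c j
  rw [hc, mul_zero] at this
  exact (smul_eq_zero.mp this.symm).resolve_right (hp.ne_zero j)

/-- The commutative star subalgebra spanned by orthogonal projections with sum `1`. -/
def IsOrthogonalProjections.spanAlgebra {k : ℕ} {p : Fin k → F}
    (hp : IsOrthogonalProjections p) (h1 : ∑ i, p i = 1) : StarSubalgebra ℂ F where
  carrier := {x | ∃ c : Fin k → ℂ, ∑ i, c i • p i = x}
  mul_mem' := by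
    rintro _ _ ⟨c, rfl⟩ ⟨d, rfl⟩
    refine ⟨c * d, ?_⟩
    rw [Finset.sum_mul]
    simp_rw [smul_mul_assoc, hp.mul_sum, smul_smul, Pi.mul_apply]
  add_mem' := by
    rintro _ _ ⟨c, rfl⟩ ⟨d, rfl⟩
    exact ⟨c + d, by simp [add_smul, Finset.sum_add_distrib]⟩
  algebraMap_mem' := fun r => ⟨fun _ => r, by
    rw [← Finset.smul_sum, h1, Algebra.algebraMap_eq_smul_one]⟩
  star_mem' := by
    rintro _ ⟨c, rfl⟩
    exact ⟨star c, by simp [star_sum, hp.star_eq]⟩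

theorem IsOrthogonalProjections.le_fdRank {F : Type u} [CStarAlgebra F] [FiniteDimensional ℂ F]
    {k : ℕ} {p : Fin k → F} (hp : IsOrthogonalProjections p) (h1 : ∑ i, p i = 1) :
    k ≤ fdRank F := by
  refine le_trans ?_ (finrank_le_fdRank (hp.spanAlgebra h1) ?_)
  · have h := finrank_span_eq_card hp.linearIndependent
    rw [Fintype.card_fin] at h
    refine h.ge.trans ?_
    refine Submodule.finrank_mono (t := Subalgebra.toSubmodule (hp.spanAlgebra h1).toSubalgebra) ?_
    rw [Submodule.span_le]
    rintro _ ⟨i, rfl⟩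
    classical
    exact ⟨Pi.single i 1, by simp [Pi.single_apply]⟩
  · rintro _ ⟨c, rfl⟩ _ ⟨d, rfl⟩
    rw [Finset.sum_mul, Finset.sum_mul]
    simp_rw [smul_mul_assoc, hp.mul_sum, smul_smul, mul_comm]

theorem finite_spectrum_real [FiniteDimensional ℂ F] (x : F) : (spectrum ℝ x).Finite := by
  rcases subsingleton_or_nontrivial F with h | h
  · rw [spectrum.of_subsingleton]; exact Set.finite_empty
  · have hint : IsIntegral ℝ x := Algebra.IsIntegral.isIntegral x
    refine ((minpoly ℝ x).rootSet_finite ℝ).subset fun t ht => ?_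
    have := spectrum.subset_polynomial_aeval x (minpoly ℝ x) ⟨t, ht, rfl⟩
    rw [minpoly.aeval, spectrum.zero_eq] at this
    rw [Polynomial.mem_rootSet]
    exact ⟨minpoly.ne_zero hint, by simpa using this⟩

theorem exists_max_isOrthogonalProjections (F : Type*) [CStarAlgebra F] [FiniteDimensional ℂ F] :
    ∃ (k : ℕ) (p : Fin k → F), IsOrthogonalProjections p ∧
      ∀ q : Fin (k + 1) → F, ¬ IsOrthogonalProjections q := by
  by_contra! h
  have : ∀ k, ∃ p : Fin k → F, IsOrthogonalProjections p := by
    intro k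
    induction k with
    | zero => exact ⟨Fin.elim0, ⟨fun i => i.elim0, fun i => i.elim0, fun i => i.elim0,
        fun i => i.elim0⟩⟩
    | succ k ih => obtain ⟨p, hp⟩ := ih; exact h k p hp
  obtain ⟨p, hp⟩ := this (Module.finrank ℂ F + 1)
  have := hp.linearIndependent.fintype_card_le_finrank
  simp at this

theorem IsOrthogonalProjections.sum_eq_one {k : ℕ} {p : Fin k → F}
    (hp : IsOrthogonalProjections p)
    (hmax : ∀ q : Fin (k + 1) → F, ¬ IsOrthogonalProjections q) : ∑ i, p i = 1 := by
  by_contra h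
  have h1 : ∀ i, p i * ∑ j, p j = p i := fun i => by simpa using hp.mul_sum 1 i
  have h1' : ∀ i, (∑ j, p j) * p i = p i := fun i => by
    have := congrArg star (h1 i)
    rwa [star_mul, star_sum, hp.star_eq, Finset.sum_congr rfl fun j _ => hp.star_eq j] at this
  refine hmax _ (hp.cons (r := 1 - ∑ i, p i) (sub_ne_zero.mpr (Ne.symm h)) ?_ ?_ fun i => ?_)
  · rw [star_sub, star_one, star_sum, Finset.sum_congr rfl fun j _ => hp.star_eq j]
  · have : (∑ i, p i) * ∑ i, p i = ∑ i, p i := by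
      conv_lhs => rw [Finset.sum_mul]
      simp_rw [h1]
    rw [sub_mul, mul_sub, mul_sub, this]
    simp
  · rw [sub_mul, one_mul, h1', sub_self]

/-- Members of a family of maximal size are minimal projections: a proper subprojection `q` would
allow replacing `pᵢ` by the two projections `q` and `pᵢ - q`. -/
theorem IsOrthogonalProjections.eq_of_le {k : ℕ} {p : Fin k → F}
    (hp : IsOrthogonalProjections p)
    (hmax : ∀ q : Fin (k + 1) → F, ¬ IsOrthogonalProjections q) (i : Fin k) {q : F} (hq : q ≠ 0)
    (hqs : star q = q) (hqq : q * q = q) (hpq : p i * q = q) : q = p i := by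
  by_contra h
  have hqp : q * p i = q := by
    have := congrArg star hpq
    rwa [star_mul, hqs, hp.star_eq] at this
  have hqj : ∀ j, i ≠ j → q * p j = 0 := fun j hj => by
    rw [← hqp, mul_assoc, hp.mul_eq_zero i j hj, mul_zero]
  have hjq : ∀ j, i ≠ j → p j * q = 0 := fun j hj => by
    rw [← hpq, ← mul_assoc, hp.mul_eq_zero j i hj.symm, zero_mul]
  have hp' : IsOrthogonalProjections (Function.update p i q) := by
    refine ⟨fun j => ?_, fun j => ?_, fun j => ?_, fun j l hjl => ?_⟩
    · by_cases hj : j = i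
      · subst hj; simpa using hq
      · simpa [hj] using hp.ne_zero j
    · by_cases hj : j = i
      · subst hj; simpa using hqs
      · simpa [hj] using hp.star_eq j
    · by_cases hj : j = i
      · subst hj; simpa using hqq
      · simpa [hj] using hp.mul_self j
    · by_cases hj : j = i
      · subst hj
        simpa [hjl.symm] using hqj l hjl
      · by_cases hl : l = i
        · subst hl
          simpa [hj] using hjq j (Ne.symm hj)
        · simpa [hj, hl] using hp.mul_eq_zero j l hjl
  refine hmax _ (hp'.cons (r := p i - q) (sub_ne_zero.mpr (Ne.symm h)) ?_ ?_ fun j => ?_)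
  · rw [star_sub, hqs, hp.star_eq]
  · rw [sub_mul, mul_sub, mul_sub, hp.mul_self, hpq, hqp, hqq, sub_self, sub_zero]
  · by_cases hj : j = i
    · subst hj
      simp [sub_mul, hpq, hqq]
    · simp [hj, sub_mul, hp.mul_eq_zero i j (Ne.symm hj), hqj j (Ne.symm hj)]

/-- The spectral projection of `x` at a non-zero spectral value `t` lies under `pᵢ`, so by
minimality it is `pᵢ`, and `x = t pᵢ`. The indicator function is admissible because the spectrum is
finite. -/
theorem IsOrthogonalProjections.exists_eq_smul_of_isSelfAdjoint [FiniteDimensional ℂ F] {k : ℕ}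
    {p : Fin k → F} (hp : IsOrthogonalProjections p)
    (hmax : ∀ q : Fin (k + 1) → F, ¬ IsOrthogonalProjections q) (i : Fin k) {x : F}
    (hx : IsSelfAdjoint x) (hpx : p i * x = x) : ∃ c : ℂ, x = c • p i := by
  by_cases hx0 : x = 0
  · exact ⟨0, by rw [hx0, zero_smul]⟩
  have hfin := finite_spectrum_real x
  obtain ⟨t, ht, ht0⟩ : ∃ t ∈ spectrum ℝ x, t ≠ 0 := by
    by_contra! h
    refine hx0 ?_
    rw [← cfc_id ℝ x, ← cfc_zero ℝ x]
    exact cfc_congr fun t ht => h t ht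
  set g : ℝ → ℝ := fun s => if s = t then 1 else 0 with hg
  have hgc : ContinuousOn g (spectrum ℝ x) := hfin.continuousOn g
  have hmul : x * cfc g x = t • cfc g x := by
    nth_rewrite 1 [← cfc_id ℝ x]
    rw [← cfc_mul id g x, ← cfc_smul t g x]
    refine cfc_congr fun s _ => ?_
    by_cases hs : s = t <;> simp [hg, hs]
  have hq0 : cfc g x ≠ 0 := by
    intro h
    rw [← cfc_zero ℝ x, cfc_eq_cfc_iff_eqOn] at h
    have := h ht
    simp [hg] at this
  have hqq : cfc g x * cfc g x = cfc g x := by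
    rw [← cfc_mul g g x]
    refine cfc_congr fun s _ => ?_
    by_cases hs : s = t <;> simp [hg, hs]
  have hqs : star (cfc g x) = cfc g x := (cfc_predicate g x : IsSelfAdjoint _).star_eq
  have hpq : p i * cfc g x = cfc g x := by
    have h1 : cfc g x = t⁻¹ • (x * cfc g x) := by
      rw [hmul, smul_smul, inv_mul_cancel₀ ht0, one_smul]
    rw [h1, mul_smul_comm, ← mul_assoc, hpx]
  have heq := hp.eq_of_le hmax i hq0 hqs hqq hpq
  rw [heq] at hmul
  refine ⟨t, ?_⟩
  rw [Complex.coe_smul, ← hmul]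
  have := congrArg star hpx
  rw [star_mul, hp.star_eq, hx.star_eq] at this
  exact this.symm

theorem IsOrthogonalProjections.exists_eq_smul [FiniteDimensional ℂ F] {k : ℕ}
    {p : Fin k → F} (hp : IsOrthogonalProjections p)
    (hmax : ∀ q : Fin (k + 1) → F, ¬ IsOrthogonalProjections q) (i : Fin k) (x : F) :
    ∃ c : ℂ, p i * x * p i = c • p i := by
  obtain ⟨c, hc⟩ := hp.exists_eq_smul_of_isSelfAdjoint hmax i (x := p i * (ℜ x : F) * p i)
    (by rw [IsSelfAdjoint, star_mul, star_mul, hp.star_eq, (ℜ x).2.star_eq, mul_assoc])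
    (by rw [← mul_assoc, ← mul_assoc, hp.mul_self])
  obtain ⟨d, hd⟩ := hp.exists_eq_smul_of_isSelfAdjoint hmax i (x := p i * (ℑ x : F) * p i)
    (by rw [IsSelfAdjoint, star_mul, star_mul, hp.star_eq, (ℑ x).2.star_eq, mul_assoc])
    (by rw [← mul_assoc, ← mul_assoc, hp.mul_self])
  refine ⟨c + Complex.I * d, ?_⟩
  conv_lhs => rw [← realPart_add_I_smul_imaginaryPart x]
  rw [mul_add, add_mul, mul_smul_comm, smul_mul_assoc, hc, hd, smul_smul, add_smul]

/-- For `k` minimal orthogonal projections with sum `1`, each of the `k²` corners `pᵢ F pⱼ` is at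
most one-dimensional, and `k ≤ fdRank F` since the projections span a commutative subalgebra. -/
theorem finrank_le_fdRank_sq (F : Type u) [CStarAlgebra F] [FiniteDimensional ℂ F] :
    Module.finrank ℂ F ≤ fdRank F ^ 2 := by
  obtain ⟨k, p, hp, hmax⟩ := exists_max_isOrthogonalProjections F
  have h1 := hp.sum_eq_one hmax
  have hcorner : ∀ ij : Fin k × Fin k, ∃ e : F, ∀ x, ∃ c : ℂ, p ij.1 * x * p ij.2 = c • e := by
    rintro ⟨i, j⟩
    by_cases h : ∀ x, p i * x * p j = 0
    · exact ⟨0, fun x => ⟨0, by rw [h, zero_smul]⟩⟩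
    push Not at h
    obtain ⟨x₀, hx₀⟩ := h
    set e := p i * x₀ * p j with he
    have hpe : p i * e = e := by rw [he, ← mul_assoc, ← mul_assoc, hp.mul_self]
    have hes : star e * p i = star e := by
      have := congrArg star hpe
      rwa [star_mul, hp.star_eq] at this
    have hps : p j * star e = star e := by
      rw [he, star_mul, hp.star_eq, ← mul_assoc, hp.mul_self]
    have hep : e * p j = e := by rw [he, mul_assoc, hp.mul_self]
    clear_value e
    -- As `e e*` is a non-zero multiple of `pᵢ`, each `pᵢ x pⱼ` is a multiple of `e (e* x pⱼ)`,
    -- whose second factor lies in `pⱼ F pⱼ = ℂ pⱼ`.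
    obtain ⟨c, hc⟩ := hp.exists_eq_smul hmax i (e * star e)
    have hc' : e * star e = c • p i := by
      rw [← hc, ← mul_assoc, hpe, mul_assoc, hes]
    have hc0 : c ≠ 0 := by
      rintro rfl
      rw [zero_smul, CStarRing.mul_star_self_eq_zero_iff] at hc'
      exact hx₀ hc'
    refine ⟨e, fun x => ?_⟩
    obtain ⟨d, hd⟩ := hp.exists_eq_smul hmax j (star e * x)
    refine ⟨c⁻¹ * d, ?_⟩
    have h3 : p i = c⁻¹ • (e * star e) := by
      rw [hc', smul_smul, inv_mul_cancel₀ hc0, one_smul]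
    have hpx : p j * (star e * x) = star e * x := by rw [← mul_assoc, hps]
    calc p i * x * p j = c⁻¹ • (e * (p j * (star e * x) * p j)) := by
          rw [h3, smul_mul_assoc, smul_mul_assoc, hpx]
          simp only [mul_assoc]
      _ = _ := by rw [hd, mul_smul_comm, hep, smul_smul]
  choose e he using hcorner
  have hspan : Submodule.span ℂ (Set.range e) = ⊤ := by
    rw [eq_top_iff]
    rintro x -
    have hx : x = ∑ i, ∑ j, p i * x * p j := by
      simp_rw [← Finset.mul_sum, h1, mul_one, ← Finset.sum_mul, h1, one_mul]
    rw [hx]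
    refine Submodule.sum_mem _ fun i _ => Submodule.sum_mem _ fun j _ => ?_
    obtain ⟨c, hc⟩ := he (i, j) x
    rw [hc]
    exact Submodule.smul_mem _ _ (Submodule.subset_span ⟨_, rfl⟩)
  have h2 := finrank_range_le_card (R := ℂ) e
  rw [Set.finrank, hspan, finrank_top, Fintype.card_prod, Fintype.card_fin, ← sq] at h2
  exact h2.trans (Nat.pow_le_pow_left (hp.le_fdRank h1) 2)

end FiniteDimensional

/-! ### The standard representation of a finite-dimensional C*-algebra. -/

section FaithfulFunctional

open scoped ComplexOrder InnerProductSpace Topology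

/-- A faithful positive functional on a C*-algebra. -/
structure FaithfulFunctional (F : Type u) [CStarAlgebra F] where
  /-- The functional. -/
  toLin : F →ₗ[ℂ] ℂ
  map_star' : ∀ x, toLin (star x) = star (toLin x)
  re_nonneg : ∀ x, 0 ≤ (toLin (star x * x)).re
  definite : ∀ x, toLin (star x * x) = 0 → x = 0

theorem coefficient_nonneg {F : Type u} [CStarAlgebra F] {p y : F} (hs : star p = p)
    (hp : p * p = p) (h0 : p ≠ 0) {c : ℂ} (h : star y * y = c • p) : 0 ≤ c := by
  have him : star c = c := by
    have h1 := congrArg star h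
    rw [star_mul, star_star, star_smul, hs, h] at h1
    exact (smul_left_injective ℂ h0 h1).symm
  have hre : ((c.re : ℝ) : ℂ) = c := Complex.conj_eq_iff_re.mp him
  rw [← hre] at h ⊢
  rw [Complex.zero_le_real]
  by_contra! hneg
  let _ : PartialOrder F := CStarAlgebra.spectralOrder F
  have _ : StarOrderedRing F := CStarAlgebra.spectralOrderedRing F
  have h2 : star y * y = -(star (√(-c.re) • p) * (√(-c.re) • p)) := by
    rw [h, star_smul, hs, star_trivial, smul_mul_smul_comm, hp, Real.mul_self_sqrt (by linarith),
      neg_smul, neg_neg, Complex.coe_smul]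
  have h3 : star y * y = 0 :=
    le_antisymm (h2.trans_le (neg_nonpos.mpr (star_mul_self_nonneg _))) (star_mul_self_nonneg _)
  rw [h3, eq_comm, smul_eq_zero] at h
  rcases h with h | h
  · rw [Complex.ofReal_eq_zero] at h
    exact hneg.ne h
  · exact h0 h

/-- The functional is the sum of the diagonal coefficients `cᵢ` in `pᵢ x pᵢ = cᵢ pᵢ`. It vanishes at
`x*x` only if every `x pᵢ` is zero. -/
theorem exists_faithfulFunctional (F : Type u) [CStarAlgebra F] [FiniteDimensional ℂ F] :
    Nonempty (FaithfulFunctional F) := by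
  obtain ⟨k, p, hp, hmax⟩ := exists_max_isOrthogonalProjections F
  have h1 := hp.sum_eq_one hmax
  choose c hc using fun i x => hp.exists_eq_smul hmax i x
  have huniq : ∀ i (z w : ℂ), z • p i = w • p i → z = w := fun i z w h =>
    smul_left_injective ℂ (hp.ne_zero i) h
  have hcs : ∀ i x, star (x * p i) * (x * p i) = c i (star x * x) • p i := by
    intro i x
    rw [← hc, star_mul, hp.star_eq]
    simp only [mul_assoc]
  have hnn : ∀ i x, 0 ≤ c i (star x * x) := fun i x =>
    coefficient_nonneg (hp.star_eq i) (hp.mul_self i) (hp.ne_zero i) (hcs i x)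
  refine ⟨⟨∑ i, ⟨⟨c i, fun x y => huniq i _ _ ?_⟩, fun z x => huniq i _ _ ?_⟩, fun x => ?_,
    fun x => ?_, fun x hx => ?_⟩⟩
  · rw [← hc, mul_add, add_mul, hc, hc, add_smul]
  · simp only [RingHom.id_apply]
    rw [← hc, mul_smul_comm, smul_mul_assoc, hc, smul_smul, smul_eq_mul]
  · simp only [LinearMap.sum_apply, star_sum]
    refine Finset.sum_congr rfl fun i _ => huniq i _ _ ?_
    change c i (star x) • p i = star (c i x) • p i
    rw [← hc, ← hp.star_eq i, ← star_smul, hp.star_eq i, ← hc, star_mul, star_mul, hp.star_eq,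
      mul_assoc]
  · rw [LinearMap.sum_apply, Complex.re_sum]
    exact Finset.sum_nonneg fun i _ => (Complex.nonneg_iff.mp (hnn i x)).1
  · rw [LinearMap.sum_apply] at hx
    have h2 := (Finset.sum_eq_zero_iff_of_nonneg fun i _ => hnn i x).mp hx
    have h3 : ∀ i, x * p i = 0 := fun i => by
      rw [← CStarRing.star_mul_self_eq_zero_iff, hcs, h2 i (Finset.mem_univ i), zero_smul]
    rw [← mul_one x, ← h1, Finset.mul_sum]
    exact Finset.sum_eq_zero fun i _ => h3 i

namespace FaithfulFunctional

variable {F : Type u} [CStarAlgebra F]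

/-- The algebra, as the underlying space of its standard representation. -/
def L2 (_f : FaithfulFunctional F) : Type u := F

variable (f : FaithfulFunctional F)

instance : AddCommGroup f.L2 := inferInstanceAs (AddCommGroup F)
instance : Module ℂ f.L2 := inferInstanceAs (Module ℂ F)
instance [h : FiniteDimensional ℂ F] : FiniteDimensional ℂ f.L2 := h

/-- The identity map onto the underlying space of the standard representation. -/
def toL2 : F ≃ₗ[ℂ] f.L2 := LinearEquiv.refl ℂ F

/-- The inner product `⟪x, y⟫ = f (x* y)`. -/
abbrev innerCore : InnerProductSpace.Core ℂ f.L2 where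
  inner x y := f.toLin (star (f.toL2.symm x) * f.toL2.symm y)
  conj_inner_symm x y := by
    rw [← Complex.star_def, ← f.map_star', star_mul, star_star]
  re_inner_nonneg x := f.re_nonneg _
  add_left x y z := by rw [map_add, star_add, add_mul, map_add]
  smul_left x y c := by
    rw [map_smul, star_smul, smul_mul_assoc, map_smul, smul_eq_mul]
    rfl
  definite x hx := f.toL2.symm.map_eq_zero_iff.mp (f.definite _ hx)

instance : NormedAddCommGroup f.L2 := f.innerCore.toNormedAddCommGroup
instance : InnerProductSpace ℂ f.L2 := InnerProductSpace.ofCore f.innerCore.toCore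
instance [FiniteDimensional ℂ F] : CompleteSpace f.L2 := FiniteDimensional.complete ℂ _

theorem inner_def (x y : f.L2) :
    ⟪x, y⟫_ℂ = f.toLin (star (f.toL2.symm x) * f.toL2.symm y) := rfl

/-- Left multiplication operators. -/
def leftMul [FiniteDimensional ℂ F] (x : F) : f.L2 →L[ℂ] f.L2 :=
  LinearMap.toContinuousLinearMap
    (f.toL2.toLinearMap ∘ₗ LinearMap.mulLeft ℂ x ∘ₗ f.toL2.symm.toLinearMap)

theorem leftMul_apply [FiniteDimensional ℂ F] (x : F) (y : f.L2) :
    f.leftMul x y = f.toL2 (x * f.toL2.symm y) := rfl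

/-- The standard representation. -/
def leftRep [FiniteDimensional ℂ F] : F →⋆ₙₐ[ℂ] (f.L2 →L[ℂ] f.L2) where
  toFun := f.leftMul
  map_smul' c x := by ext y; simp [leftMul_apply]
  map_zero' := by ext y; simp [leftMul_apply]
  map_add' x y := by ext z; simp [leftMul_apply, add_mul]
  map_mul' x y := by ext z; simp [leftMul_apply, mul_assoc]
  map_star' x := by
    rw [ContinuousLinearMap.star_eq_adjoint, ContinuousLinearMap.eq_adjoint_iff]
    intro y z
    simp [inner_def, leftMul_apply, mul_assoc]

theorem leftRep_injective [FiniteDimensional ℂ F] : Function.Injective f.leftRep := by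
  intro x y h
  have := DFunLike.congr_fun h (f.toL2 1)
  simpa [leftRep, leftMul_apply] using this

theorem leftRep_one [FiniteDimensional ℂ F] : f.leftRep 1 = 1 := by
  ext y; simp [leftRep, leftMul_apply]

end FaithfulFunctional

theorem finrank_continuousLinearMap_self (K : Type u) [NormedAddCommGroup K]
    [InnerProductSpace ℂ K] [FiniteDimensional ℂ K] :
    Module.finrank ℂ (K →L[ℂ] K) = Module.finrank ℂ K ^ 2 := by
  rw [← (LinearMap.toContinuousLinearMap (𝕜 := ℂ) (E := K) (F' := K)).finrank_eq,
    Module.finrank_linearMap, sq]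

/-- A finite-dimensional C*-algebra embeds, without containing the unit, into the operators on a
Hilbert space of dimension one more than its own. -/
theorem exists_nonunital_embedding (F : Type u) [CStarAlgebra F] [FiniteDimensional ℂ F] :
    ∃ (K : Type u) (_ : NormedAddCommGroup K) (_ : InnerProductSpace ℂ K) (_ : CompleteSpace K)
      (_ : FiniteDimensional ℂ K) (j : F →⋆ₙₐ[ℂ] (K →L[ℂ] K)), Function.Injective j ∧
        (1 : K →L[ℂ] K) ∉ Set.range j ∧ Module.finrank ℂ K = Module.finrank ℂ F + 1 := by
  -- The extra summand `ℂ` keeps the unit out of the image of `F × 0`, at the cost of one dimension.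
  obtain ⟨f⟩ := exists_faithfulFunctional (F × ℂ)
  refine ⟨f.L2, inferInstance, inferInstance, inferInstance, inferInstance,
    f.leftRep.comp (NonUnitalStarAlgHom.inl ℂ F ℂ), ?_, ?_, ?_⟩
  · intro x y h
    have := f.leftRep_injective h
    simpa using this
  · rintro ⟨x, hx⟩
    rw [← f.leftRep_one] at hx
    have := congrArg Prod.snd (f.leftRep_injective hx)
    simp at this
  · rw [← f.toL2.finrank_eq, Module.finrank_prod, Module.finrank_self]

end FaithfulFunctional

/-! ### Subexponential growth. -/

section Growth

open scoped Topology

theorem log_div_le_iff {x : ENNReal} {n : ℕ} (hn : 0 < n) (ε : ℝ) :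
    ENNReal.log x / ((n : ℝ) : EReal) ≤ (ε : EReal) ↔ x ≤ ENNReal.ofReal (Real.exp (n * ε)) := by
  rw [EReal.div_le_iff_le_mul (by exact_mod_cast hn) (EReal.coe_ne_top _), ← EReal.coe_mul,
    ← EReal.exp_coe, ← EReal.expOrderIso_apply, ← ENNReal.logOrderIso_apply,
    ← ENNReal.logOrderIso_symm, OrderIso.le_symm_apply]

theorem growthRate_le_zero_iff {r : ℕ → ℕ∞} : growthRate r ≤ 0 ↔
    ∀ ε : ℝ, 0 < ε → ∀ᶠ n : ℕ in atTop, ((r n : ℕ∞) : ENNReal) ≤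
      ENNReal.ofReal (Real.exp (n * ε)) := by
  constructor
  · intro h ε hε
    have h1 : growthRate r < (ε : EReal) := h.trans_lt (by exact_mod_cast hε)
    filter_upwards [eventually_lt_of_limsup_lt h1, eventually_gt_atTop 0] with n hn hn0
    exact (log_div_le_iff hn0 ε).mp hn.le
  · intro h
    refine EReal.le_of_forall_lt_iff_le.mp fun ε hε => ?_
    have hε' : 0 < ε := by exact_mod_cast hε
    refine limsup_le_of_le (by isBoundedDefault) ?_
    filter_upwards [h ε hε', eventually_gt_atTop 0] with n hn hn0
    exact (log_div_le_iff hn0 ε).mpr hn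

/-- Subexponential growth is stable under shifts and polynomial changes. -/
theorem growthRate_le_zero_of_le {r r' : ℕ → ℕ∞} (m : ℕ)
    (h : ∀ n, r' n ≤ (r (n + m) ^ 2 + 1) ^ 2) (hr : growthRate r ≤ 0) : growthRate r' ≤ 0 := by
  rw [growthRate_le_zero_iff] at *
  intro ε hε
  -- The fourth power turns the rate `ε / 8` into `ε / 2`; the other half of `ε` absorbs the factor
  -- `4` and the shift by `m` for large `n`.
  have h1 := (tendsto_add_atTop_nat m).eventually (hr (ε / 8) (by positivity))
  have h2 : ∀ᶠ n : ℕ in atTop, (Real.log 4 + ε / 2 * m) / (ε / 2) ≤ n :=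
    tendsto_natCast_atTop_atTop.eventually_ge_atTop _
  filter_upwards [h1, h2] with n hn hn2
  set X : ℝ := Real.exp (((n + m : ℕ) : ℝ) * (ε / 8)) with hX
  have hX1 : 1 ≤ X := Real.one_le_exp (by positivity)
  have h3 : ((r' n : ℕ∞) : ENNReal) ≤ ((r (n + m) : ENNReal) ^ 2 + 1) ^ 2 := by
    have := ENat.toENNReal_le.mpr (h n)
    simpa using this
  refine h3.trans ?_
  calc ((r (n + m) : ENNReal) ^ 2 + 1) ^ 2 ≤ (ENNReal.ofReal X ^ 2 + 1) ^ 2 := by gcongr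
    _ = ENNReal.ofReal ((X ^ 2 + 1) ^ 2) := by
      rw [ENNReal.ofReal_pow (by positivity), ENNReal.ofReal_add (by positivity) zero_le_one,
        ENNReal.ofReal_pow (by positivity), ENNReal.ofReal_one]
    _ ≤ ENNReal.ofReal (Real.exp (n * ε)) := by
      refine ENNReal.ofReal_le_ofReal ?_
      have h4 : (X ^ 2 + 1) ^ 2 ≤ 4 * X ^ 4 := by
        have : X ^ 2 + 1 ≤ 2 * X ^ 2 := by nlinarith
        calc (X ^ 2 + 1) ^ 2 ≤ (2 * X ^ 2) ^ 2 := by gcongr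
          _ = 4 * X ^ 4 := by ring
      refine h4.trans ?_
      have h5 : 4 * X ^ 4 = Real.exp (Real.log 4 + (n + m) * (ε / 2)) := by
        rw [Real.exp_add, Real.exp_log (by norm_num), hX, ← Real.exp_nat_mul]
        push_cast
        ring_nf
      rw [h5, Real.exp_le_exp]
      rw [div_le_iff₀ (by positivity)] at hn2
      linarith

end Growth

/-! ### Asymptotic multiplicative domains. -/

section MultiplicativeDomain

open scoped ComplexOrder InnerProductSpace Topology
open Matrix

variable {A : Type*} [CStarAlgebra A]
variable {K : Type*} [NormedAddCommGroup K] [InnerProductSpace ℂ K] [CompleteSpace K]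

theorem KernelPositive.map_star {φ : A →ₗ[ℂ] (K →L[ℂ] K)} (h : KernelPositive φ) (a : A) :
    φ (star a) = star (φ a) :=
  h.map_star_of_left_unit (e := 1) (by simp) a

theorem KernelPositive.contractive {φ : A →ₗ[ℂ] (K →L[ℂ] K)} (h : KernelPositive φ)
    (h1 : φ 1 = 1) (a : A) : ‖φ a‖ ≤ ‖a‖ := by
  refine (h.norm_le a).trans ?_
  rw [h1]
  simpa using mul_le_mul_of_nonneg_right (norm_one_le_one (K →L[ℂ] K)) (norm_nonneg a)

/-- The failure of multiplicativity `φ (a* b) - φ (a)* φ (b)`. -/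
def schwarzDefect (φ : A →ₗ[ℂ] (K →L[ℂ] K)) (a b : A) : K →L[ℂ] K :=
  φ (star a * b) - star (φ a) * φ b

/-- Adjoining the algebra element `1` with vector `-y`, where `y = ∑ φ (aⱼ) xⱼ`, completes the
square in the kernel of `φ`. -/
theorem KernelPositive.schwarzDefect_nonneg {φ : A →ₗ[ℂ] (K →L[ℂ] K)} (h : KernelPositive φ)
    (h1 : φ 1 = 1) {k : ℕ} (a : Fin k → A) (x : Fin k → K) :
    0 ≤ ∑ i, ∑ j, ⟪x i, schwarzDefect φ (a i) (a j) (x j)⟫_ℂ := by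
  set y := ∑ j, φ (a j) (x j) with hy
  have h0 := h (k + 1) (Fin.cons 1 a) (Fin.cons (-y) x)
  simp only [Fin.sum_univ_succ, Fin.cons_zero, Fin.cons_succ, star_one, one_mul, mul_one, h1,
    h.map_star, ContinuousLinearMap.star_eq_adjoint, ContinuousLinearMap.adjoint_inner_right,
    one_apply_eq_self, Finset.sum_add_distrib] at h0
  have e1 : ∑ j, ⟪-y, φ (a j) (x j)⟫_ℂ = -⟪y, y⟫_ℂ := by
    rw [← inner_sum, ← hy, inner_neg_left]
  have e2 : ∑ i, ⟪φ (a i) (x i), -y⟫_ℂ = -⟪y, y⟫_ℂ := by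
    rw [← sum_inner, ← hy, inner_neg_right]
  rw [e1, e2, inner_neg_left, inner_neg_right] at h0
  have h2 : ∑ i, ∑ j, ⟪x i, schwarzDefect φ (a i) (a j) (x j)⟫_ℂ =
      ∑ i, ∑ j, ⟪x i, φ (star (a i) * a j) (x j)⟫_ℂ - ⟪y, y⟫_ℂ := by
    have h3 : ⟪y, y⟫_ℂ = ∑ i, ∑ j, ⟪x i, (star (φ (a i)) * φ (a j)) (x j)⟫_ℂ := by
      rw [hy, sum_inner]
      refine Finset.sum_congr rfl fun i _ => ?_
      rw [inner_sum]
      refine Finset.sum_congr rfl fun j _ => ?_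
      rw [mul_apply_eq_comp, ContinuousLinearMap.star_eq_adjoint,
        ContinuousLinearMap.adjoint_inner_right]
    rw [h3, ← Finset.sum_sub_distrib]
    refine Finset.sum_congr rfl fun i _ => ?_
    rw [← Finset.sum_sub_distrib]
    refine Finset.sum_congr rfl fun j _ => ?_
    rw [← inner_sub_right]
    rfl
  rw [h2]
  refine h0.trans_eq ?_
  ring

/-- The two-by-two matrix of defects is a Gram matrix `N*N`, and the entries of `N` are controlled
by the diagonal defects. The factor `4` comes from estimating two products separately; only the
limit `0` matters later. -/
theorem KernelPositive.norm_schwarzDefect_sq_le {φ : A →ₗ[ℂ] (K →L[ℂ] K)} (h : KernelPositive φ)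
    (h1 : φ 1 = 1) (a b : A) :
    ‖schwarzDefect φ a b‖ ^ 2 ≤ 4 * (‖schwarzDefect φ a a‖ * ‖schwarzDefect φ b b‖) := by
  obtain ⟨N, hN⟩ := exists_eq_conjTranspose_mul
    (Matrix.of fun i j => schwarzDefect φ (![a, b] i) (![a, b] j))
    (fun x => h.schwarzDefect_nonneg h1 ![a, b] x)
  have hent : ∀ i j, schwarzDefect φ (![a, b] i) (![a, b] j) =
      star (N 0 i) * N 0 j + star (N 1 i) * N 1 j := by
    intro i j
    have := congrFun (congrFun hN i) j
    simpa [Matrix.mul_apply, Fin.sum_univ_two] using this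
  have hle : ∀ t i, ‖N t i‖ ^ 2 ≤ ‖schwarzDefect φ (![a, b] i) (![a, b] i)‖ := by
    intro t i
    rw [sq, ← CStarRing.norm_star_mul_self, hent i i]
    refine CStarAlgebra.norm_le_norm_of_nonneg_of_le (star_mul_self_nonneg _) ?_
    fin_cases t
    · exact le_add_of_nonneg_right (star_mul_self_nonneg _)
    · exact le_add_of_nonneg_left (star_mul_self_nonneg _)
  have hab := hent 0 1
  have ha0 := hle 0 0
  have ha1 := hle 1 0
  have hb0 := hle 0 1
  have hb1 := hle 1 1
  simp only [Matrix.cons_val_zero, Matrix.cons_val_one] at hab ha0 ha1 hb0 hb1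
  have hn : ‖schwarzDefect φ a b‖ ≤ ‖N 0 0‖ * ‖N 0 1‖ + ‖N 1 0‖ * ‖N 1 1‖ := by
    rw [hab]
    refine (norm_add_le _ _).trans ?_
    gcongr <;> exact (norm_mul_le _ _).trans_eq (by rw [norm_star])
  have e1 := mul_le_mul ha0 hb0 (by positivity) (norm_nonneg _)
  have e2 := mul_le_mul ha1 hb1 (by positivity) (norm_nonneg _)
  calc ‖schwarzDefect φ a b‖ ^ 2 ≤ (‖N 0 0‖ * ‖N 0 1‖ + ‖N 1 0‖ * ‖N 1 1‖) ^ 2 := by gcongr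
    _ ≤ 2 * (‖N 0 0‖ ^ 2 * ‖N 0 1‖ ^ 2 + ‖N 1 0‖ ^ 2 * ‖N 1 1‖ ^ 2) := by
      nlinarith [sq_nonneg (‖N 0 0‖ * ‖N 0 1‖ - ‖N 1 0‖ * ‖N 1 1‖)]
    _ ≤ _ := by linarith

/-- A family of unital completely positive maps `θ`, to be compared with a family of unital
`*`-homomorphisms `σ` along a filter. -/
structure UCPFamily (A K : Type*) [CStarAlgebra A] [NormedAddCommGroup K]
    [InnerProductSpace ℂ K] [CompleteSpace K] (T : Type*) where
  /-- The unital completely positive maps. -/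
  θ : T → A →ₗ[ℂ] (K →L[ℂ] K)
  /-- The unital `*`-homomorphisms. -/
  σ : T → A →⋆ₙₐ[ℂ] (K →L[ℂ] K)
  kernelPositive : ∀ t, KernelPositive (θ t)
  θ_one : ∀ t, θ t 1 = 1
  σ_one : ∀ t, σ t 1 = 1

namespace UCPFamily

variable {T : Type*} (P : UCPFamily A K T) (l : Filter T)

/-- Asymptotic agreement of `θ` and `σ` at a point. -/
def Agree (x : A) : Prop := Tendsto (fun t => P.θ t x - P.σ t x) l (𝓝 0)

theorem norm_θ_le (t : T) (x : A) : ‖P.θ t x‖ ≤ ‖x‖ :=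
  (P.kernelPositive t).contractive (P.θ_one t) x

theorem norm_σ_le (t : T) (x : A) : ‖P.σ t x‖ ≤ ‖x‖ := NonUnitalStarAlgHom.norm_apply_le _ x

variable {P l}

theorem Agree.add {x y : A} (hx : P.Agree l x) (hy : P.Agree l y) : P.Agree l (x + y) := by
  have := Tendsto.add hx hy
  rw [add_zero] at this
  refine this.congr fun t => ?_
  rw [map_add, map_add]; abel

theorem Agree.smul {x : A} (c : ℂ) (hx : P.Agree l x) : P.Agree l (c • x) := by
  have := Tendsto.const_smul hx c
  rw [smul_zero] at this
  refine this.congr fun t => ?_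
  rw [map_smul, map_smul, smul_sub]

theorem agree_zero : P.Agree l 0 := by
  simpa [Agree] using tendsto_const_nhds

theorem agree_one : P.Agree l 1 := by
  simpa [Agree, P.θ_one, P.σ_one] using tendsto_const_nhds

theorem Agree.star {x : A} (hx : P.Agree l x) : P.Agree l (star x) := by
  have := (continuous_star.tendsto (0 : K →L[ℂ] K)).comp hx
  rw [star_zero] at this
  refine this.congr fun t => ?_
  rw [Function.comp_apply, star_sub, (P.kernelPositive t).map_star, StarHomClass.map_star]

theorem tendsto_mul_sub_mul {a b c d : T → K →L[ℂ] K} {M N : ℝ}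
    (h1 : Tendsto (fun t => a t - c t) l (𝓝 0)) (h2 : Tendsto (fun t => b t - d t) l (𝓝 0))
    (ha : ∀ t, ‖a t‖ ≤ M) (hd : ∀ t, ‖d t‖ ≤ N) :
    Tendsto (fun t => a t * b t - c t * d t) l (𝓝 0) := by
  have h3 : Tendsto (fun t => M * ‖b t - d t‖ + ‖a t - c t‖ * N) l (𝓝 0) := by
    have := (h2.norm.const_mul M).add (h1.norm.mul_const N)
    simpa using this
  refine squeeze_zero_norm (fun t => ?_) h3
  calc ‖a t * b t - c t * d t‖ = ‖a t * (b t - d t) + (a t - c t) * d t‖ := by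
        congr 1; noncomm_ring
    _ ≤ ‖a t * (b t - d t)‖ + ‖(a t - c t) * d t‖ := norm_add_le _ _
    _ ≤ ‖a t‖ * ‖b t - d t‖ + ‖a t - c t‖ * ‖d t‖ :=
        add_le_add (norm_mul_le _ _) (norm_mul_le _ _)
    _ ≤ _ := by gcongr <;> [exact ha t; exact hd t]

variable (P l) in
/-- The asymptotic multiplicative domain. -/
def Multiplicative (x : A) : Prop :=
  P.Agree l x ∧ P.Agree l (star x * x) ∧ P.Agree l (x * star x)

theorem Multiplicative.star {x : A} (hx : P.Multiplicative l x) :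
    P.Multiplicative l (star x) :=
  ⟨hx.1.star, by rw [star_star]; exact hx.2.2, by rw [star_star]; exact hx.2.1⟩

/-- The defect at `(x*, x*)` tends to `0`, so the defect at `(x*, y)` does too by Cauchy–Schwarz.
Thus `θ (xy)` is asymptotically `θ x θ y`, hence `σ x σ y`; plain agreement at `y` suffices. -/
theorem Multiplicative.agree_mul {x y : A} (hx : P.Multiplicative l x) (hy : P.Agree l y) :
    P.Agree l (x * y) := by
  have hxx : Tendsto (fun t => schwarzDefect (P.θ t) (Star.star x) (Star.star x)) l (𝓝 0) := by
    have h1 := tendsto_mul_sub_mul hx.1.star.star hx.1.star (M := ‖x‖) (N := ‖x‖)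
      (fun t => (P.norm_θ_le t _).trans_eq (by rw [star_star]))
      (fun t => (P.norm_σ_le t _).trans_eq (norm_star x))
    have h2 := Tendsto.sub hx.2.2 h1
    rw [sub_zero] at h2
    refine h2.congr fun t => ?_
    rw [schwarzDefect, ← (P.kernelPositive t).map_star, star_star, map_mul (P.σ t)]
    abel
  have hD : Tendsto (fun t => schwarzDefect (P.θ t) (Star.star x) y) l (𝓝 0) := by
    have hyy : ∀ t, ‖schwarzDefect (P.θ t) y y‖ ≤ 2 * ‖y‖ ^ 2 := by
      intro t
      calc ‖schwarzDefect (P.θ t) y y‖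
          ≤ ‖P.θ t (Star.star y * y)‖ + ‖Star.star (P.θ t y) * P.θ t y‖ := norm_sub_le _ _
        _ ≤ ‖y‖ ^ 2 + ‖y‖ ^ 2 := by
          refine add_le_add ((P.norm_θ_le t _).trans_eq ?_) ?_
          · rw [CStarRing.norm_star_mul_self, sq]
          · rw [CStarRing.norm_star_mul_self, sq]
            exact mul_self_le_mul_self (norm_nonneg _) (P.norm_θ_le t y)
        _ = _ := by ring
    rw [tendsto_zero_iff_norm_tendsto_zero]
    have h3 : Tendsto (fun t => √(4 * (‖schwarzDefect (P.θ t) (Star.star x) (Star.star x)‖ *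
        (2 * ‖y‖ ^ 2)))) l (𝓝 0) := by
      have := ((hxx.norm.mul_const (2 * ‖y‖ ^ 2)).const_mul 4).sqrt
      simpa using this
    refine squeeze_zero (fun _ => norm_nonneg _) (fun t => Real.le_sqrt_of_sq_le ?_) h3
    refine ((P.kernelPositive t).norm_schwarzDefect_sq_le (P.θ_one t) _ _).trans ?_
    gcongr
    exact hyy t
  have hprod := tendsto_mul_sub_mul hx.1 hy (M := ‖x‖) (N := ‖y‖)
    (fun t => P.norm_θ_le t x) (fun t => P.norm_σ_le t y)
  have := Tendsto.add hD hprod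
  rw [add_zero] at this
  refine this.congr fun t => ?_
  rw [schwarzDefect, ← (P.kernelPositive t).map_star, star_star, map_mul (P.σ t)]
  abel

theorem Multiplicative.add {x y : A} (hx : P.Multiplicative l x) (hy : P.Multiplicative l y) :
    P.Multiplicative l (x + y) := by
  refine ⟨hx.1.add hy.1, ?_, ?_⟩
  · rw [star_add, add_mul, mul_add, mul_add]
    exact ((hx.star.agree_mul hx.1).add (hx.star.agree_mul hy.1)).add
      ((hy.star.agree_mul hx.1).add (hy.star.agree_mul hy.1))
  · rw [star_add, add_mul, mul_add, mul_add]
    exact ((hx.agree_mul hx.1.star).add (hx.agree_mul hy.1.star)).add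
      ((hy.agree_mul hx.1.star).add (hy.agree_mul hy.1.star))

theorem Multiplicative.mul {x y : A} (hx : P.Multiplicative l x) (hy : P.Multiplicative l y) :
    P.Multiplicative l (x * y) := by
  refine ⟨hx.agree_mul hy.1, ?_, ?_⟩
  · rw [star_mul, mul_assoc]
    exact hy.star.agree_mul (hx.star.agree_mul (hx.agree_mul hy.1))
  · rw [star_mul, mul_assoc]
    exact hx.agree_mul (hy.agree_mul (hy.star.agree_mul hx.1.star))

theorem Multiplicative.smul {x : A} (c : ℂ) (hx : P.Multiplicative l x) :
    P.Multiplicative l (c • x) := by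
  refine ⟨hx.1.smul c, ?_, ?_⟩
  · rw [star_smul, smul_mul_smul_comm]
    exact hx.2.1.smul _
  · rw [star_smul, smul_mul_smul_comm]
    exact hx.2.2.smul _

variable (P l) in
/-- The asymptotic multiplicative domain as a star subalgebra. -/
def multiplicativeDomain : NonUnitalStarSubalgebra ℂ A where
  carrier := {x | P.Multiplicative l x}
  add_mem' := Multiplicative.add
  zero_mem' := ⟨agree_zero, by simpa using agree_zero, by simpa using agree_zero⟩
  mul_mem' := Multiplicative.mul
  smul_mem' := fun c _ hx => Multiplicative.smul c hx
  star_mem' := Multiplicative.star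

theorem isClosed_setOf_agree : IsClosed {x | P.Agree l x} := by
  refine isClosed_of_closure_subset fun x hx => ?_
  rw [Set.mem_ofPred_eq, Agree, Metric.tendsto_nhds]
  intro ε hε
  obtain ⟨y, hy, hxy⟩ := Metric.mem_closure_iff.mp hx (ε / 3) (by positivity)
  filter_upwards [Metric.tendsto_nhds.mp hy (ε / 3) (by positivity)] with t ht
  rw [dist_zero_right] at ht ⊢
  rw [dist_eq_norm] at hxy
  calc ‖P.θ t x - P.σ t x‖
      = ‖P.θ t (x - y) - P.σ t (x - y) + (P.θ t y - P.σ t y)‖ := by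
        congr 1; rw [map_sub, map_sub]; abel
    _ ≤ ‖P.θ t (x - y)‖ + ‖P.σ t (x - y)‖ + ‖P.θ t y - P.σ t y‖ :=
        (norm_add_le _ _).trans (add_le_add_left (norm_sub_le _ _) _)
    _ ≤ ‖x - y‖ + ‖x - y‖ + ‖P.θ t y - P.σ t y‖ := by
        gcongr <;> [exact P.norm_θ_le t _; exact P.norm_σ_le t _]
    _ < ε := by linarith

theorem isClosed_multiplicativeDomain :
    IsClosed (P.multiplicativeDomain l : Set A) := by
  have hc : IsClosed {x | P.Agree l x} := isClosed_setOf_agree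
  exact hc.inter ((hc.preimage (by fun_prop : Continuous fun x : A => Star.star x * x)).inter
    (hc.preimage (by fun_prop : Continuous fun x : A => x * Star.star x)))

/-- Asymptotic agreement on unitaries extends to the C*-algebra that they generate. -/
theorem agree_of_mem_topologicalClosure {S : Set A} (hS : ∀ x ∈ S, x ∈ unitary A)
    (h : ∀ x ∈ S, P.Agree l x) {x : A}
    (hx : x ∈ (NonUnitalStarAlgebra.adjoin ℂ S).topologicalClosure) : P.Agree l x := by
  have hle : NonUnitalStarAlgebra.adjoin ℂ S ≤ P.multiplicativeDomain l := by
    -- For a unitary both `y*y` and `yy*` are `1`, where agreement is automatic.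
    refine NonUnitalStarAlgebra.adjoin_le fun y hy => ⟨h y hy, ?_, ?_⟩
    · rw [Unitary.star_mul_self_of_mem (hS y hy)]
      exact agree_one
    · rw [Unitary.mul_star_self_of_mem (hS y hy)]
      exact agree_one
  exact (NonUnitalStarSubalgebra.topologicalClosure_minimal _ hle
    isClosed_multiplicativeDomain hx).1

end UCPFamily

end MultiplicativeDomain

/-! ### Change of representation and powers of the automorphism. -/

section Representation

open scoped Topology

/-- Change of the Hilbert space of a faithful representation by a completely positive map. -/
theorem exists_change_of_rep {D : Type*} [NonUnitalCStarAlgebra D]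
    {H₁ H₂ : Type*} [NormedAddCommGroup H₁] [InnerProductSpace ℂ H₁] [CompleteSpace H₁]
    [NormedAddCommGroup H₂] [InnerProductSpace ℂ H₂] [CompleteSpace H₂]
    (ι : D →⋆ₙₐ[ℂ] (H₁ →L[ℂ] H₁)) (hι : Function.Injective ι) (ρ : D →⋆ₙₐ[ℂ] (H₂ →L[ℂ] H₂)) :
    ∃ E : (H₁ →L[ℂ] H₁) →ₗ[ℂ] (H₂ →L[ℂ] H₂), KernelPositive E ∧ (∀ a, ‖E a‖ ≤ ‖a‖) ∧
      ∀ d, E (ι d) = ρ d := by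
  obtain ⟨E, h1, h2, h3, -⟩ := exists_contractive_extension ι hι (homLin ρ)
    (isCompletelyPositive_homLin ρ).kernelPositive
    fun b => NonUnitalStarAlgHom.norm_apply_le ρ b
  exact ⟨E, h1, h2, h3⟩

variable {A : Type u} [CStarAlgebra A]

/-- The powers of an automorphism as `*`-homomorphisms. -/
def powHom (α : A ≃⋆ₐ[ℂ] A) : ℕ → A →⋆ₙₐ[ℂ] A
  | 0 => NonUnitalStarAlgHom.id ℂ A
  | n + 1 => (powHom α n).comp (α : A →⋆ₙₐ[ℂ] A)

theorem powHom_apply (α : A ≃⋆ₐ[ℂ] A) (n : ℕ) (x : A) : powHom α n x = (⇑α)^[n] x := by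
  induction n generalizing x with
  | zero => rfl
  | succ n ih => rw [Function.iterate_succ_apply, ← ih]; rfl

theorem powHom_injective (α : A ≃⋆ₐ[ℂ] A) (n : ℕ) : Function.Injective (powHom α n) := by
  have : ⇑(powHom α n) = (⇑α)^[n] := funext (powHom_apply α n)
  rw [this]
  exact (EquivLike.injective α).iterate n

theorem powHom_one (α : A ≃⋆ₐ[ℂ] A) (n : ℕ) : powHom α n 1 = 1 := by
  rw [powHom_apply]
  exact Function.iterate_fixed (map_one α) n

theorem coe_restrict_iterate (α : A ≃⋆ₐ[ℂ] A) (B : NonUnitalStarSubalgebra ℂ A)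
    (h : α '' (B : Set A) = B) (n : ℕ) (x : B) :
    (((⇑(restrict α B h))^[n] x : B) : A) = (⇑α)^[n] x := by
  induction n generalizing x with
  | zero => rfl
  | succ n ih => rw [Function.iterate_succ_apply, Function.iterate_succ_apply, ih]; rfl

theorem mem_orbit {A : Type u} [NonUnitalCStarAlgebra A] {α : A ≃⋆ₐ[ℂ] A} {Ω : Set A} {n : ℕ}
    {y : A} : y ∈ orbit α Ω n ↔ ∃ i < n, ∃ x ∈ Ω, (⇑α)^[i] x = y := by
  simp [orbit]

theorem mem_topologicalClosure_adjoin {S : Set A} (σ : A →⋆ₙₐ[ℂ] A) (hσ : ∀ y ∈ S, σ y ∈ S)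
    {y : A} (hy : y ∈ (NonUnitalStarAlgebra.adjoin ℂ S).topologicalClosure) :
    σ y ∈ (NonUnitalStarAlgebra.adjoin ℂ S).topologicalClosure := by
  set B := (NonUnitalStarAlgebra.adjoin ℂ S).topologicalClosure with hB
  have hcont : Continuous σ :=
    AddMonoidHomClass.continuous_of_bound σ 1 fun x => by
      simpa using NonUnitalStarAlgHom.norm_apply_le σ x
  have hle : NonUnitalStarAlgebra.adjoin ℂ S ≤ NonUnitalStarSubalgebra.comap σ B := by
    refine NonUnitalStarAlgebra.adjoin_le fun z hz => ?_
    exact NonUnitalStarSubalgebra.le_topologicalClosure _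
      (NonUnitalStarAlgebra.subset_adjoin ℂ S (hσ z hz))
  exact NonUnitalStarSubalgebra.topologicalClosure_minimal _ hle
    ((NonUnitalStarSubalgebra.isClosed_topologicalClosure _).preimage hcont) hy

theorem le_sq_add_one_sq (c : ℕ∞) : c ≤ (c ^ 2 + 1) ^ 2 := by
  induction c using ENat.recTopCoe with
  | top => simp
  | coe n =>
    norm_cast
    nlinarith [sq_nonneg n]

end Representation

/-! ### From positive entropy of subalgebras to unitaries. -/

section Generation

variable {A : Type u} [CStarAlgebra A]

/-- The full orbit, in both time directions, of a point under an automorphism. -/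
def fullOrbit (α : A ≃⋆ₐ[ℂ] A) (x : A) : Set A := {y | ∃ i j : ℕ, (⇑α)^[j] y = (⇑α)^[i] x}

/-- The C*-algebra generated by the full orbit of a point. -/
def orbitAlgebra (α : A ≃⋆ₐ[ℂ] A) (x : A) : NonUnitalStarSubalgebra ℂ A :=
  (NonUnitalStarAlgebra.adjoin ℂ (fullOrbit α x)).topologicalClosure

theorem isClosed_orbitAlgebra (α : A ≃⋆ₐ[ℂ] A) (x : A) : IsClosed (orbitAlgebra α x : Set A) :=
  NonUnitalStarSubalgebra.isClosed_topologicalClosure _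

theorem mem_orbitAlgebra_self (α : A ≃⋆ₐ[ℂ] A) (x : A) : x ∈ orbitAlgebra α x :=
  NonUnitalStarSubalgebra.le_topologicalClosure _
    (NonUnitalStarAlgebra.subset_adjoin ℂ _ ⟨0, 0, rfl⟩)

theorem image_orbitAlgebra (α : A ≃⋆ₐ[ℂ] A) (x : A) :
    α '' (orbitAlgebra α x : Set A) = orbitAlgebra α x := by
  refine Set.Subset.antisymm ?_ fun y hy => ?_
  · rintro _ ⟨y, hy, rfl⟩
    refine mem_topologicalClosure_adjoin (α : A →⋆ₙₐ[ℂ] A) ?_ hy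
    rintro z ⟨i, j, h⟩
    refine ⟨i + 1, j, ?_⟩
    change (⇑α)^[j] (α z) = _
    rw [← Function.iterate_succ_apply, Function.iterate_succ_apply', h,
      Function.iterate_succ_apply']
  · refine ⟨α.symm y, ?_, α.apply_symm_apply y⟩
    refine mem_topologicalClosure_adjoin (α.symm : A →⋆ₙₐ[ℂ] A) ?_ hy
    rintro z ⟨i, j, h⟩
    refine ⟨i, j + 1, ?_⟩
    change (⇑α)^[j + 1] (α.symm z) = _
    rw [Function.iterate_succ_apply, α.apply_symm_apply, h]

theorem iterate_mem_unitary (α : A ≃⋆ₐ[ℂ] A) {x : A} (hx : x ∈ unitary A) (n : ℕ) :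
    (⇑α)^[n] x ∈ unitary A := by
  rw [← powHom_apply, Unitary.mem_iff, ← map_star, ← map_mul, ← map_mul,
    Unitary.star_mul_self_of_mem hx, Unitary.mul_star_self_of_mem hx, powHom_one]
  exact ⟨rfl, rfl⟩

theorem fullOrbit_subset_unitary (α : A ≃⋆ₐ[ℂ] A) {x : A} (hx : x ∈ unitary A) :
    ∀ y ∈ fullOrbit α x, y ∈ unitary A := by
  rintro y ⟨i, j, h⟩
  have := iterate_mem_unitary α hx i
  rw [← h, ← powHom_apply, Unitary.mem_iff, ← map_star, ← map_mul, ← map_mul] at this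
  rw [Unitary.mem_iff]
  exact ⟨powHom_injective α j (this.1.trans (powHom_one α j).symm),
    powHom_injective α j (this.2.trans (powHom_one α j).symm)⟩

open scoped Topology in
/-- Unital completely positive maps which almost agree with a homomorphism on a long piece of the
orbit of a unitary almost agree with it on a given finite set of the generated C*-algebra. -/
theorem exists_uniform_agree (α : A ≃⋆ₐ[ℂ] A) {x : A} (hx : x ∈ unitary A) (K : Type*)
    [NormedAddCommGroup K] [InnerProductSpace ℂ K] [CompleteSpace K] {Ω : Set A} (hΩ : Ω.Finite)
    (hΩx : ∀ a ∈ Ω, a ∈ orbitAlgebra α x) {ε : ℝ} (hε : 0 < ε) :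
    ∃ N : ℕ, ∃ δ > 0, ∀ (θ : A →ₗ[ℂ] (K →L[ℂ] K)) (σ : A →⋆ₙₐ[ℂ] (K →L[ℂ] K)),
      KernelPositive θ → θ 1 = 1 → σ 1 = 1 →
      (∀ y, ∀ i ≤ N, ∀ j ≤ N, (⇑α)^[j] y = (⇑α)^[i] x → ‖θ y - σ y‖ < δ) →
      ∀ a ∈ Ω, ‖θ a - σ a‖ < ε := by
  -- Failure for every `N` with `δ = 1/(N+1)` yields sequences of maps that agree asymptotically on
  -- the full orbit, hence on the generated algebra; finiteness of `Ω` makes this uniform.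
  by_contra! h
  choose θ σ hθ hθ1 hσ1 hclose a ha hle using fun N : ℕ => h N (1 / ((N : ℝ) + 1)) (by positivity)
  let P : UCPFamily A K ℕ := ⟨θ, σ, hθ, hθ1, hσ1⟩
  have hgen : ∀ y ∈ fullOrbit α x, P.Agree atTop y := by
    rintro y ⟨i, j, hy⟩
    refine squeeze_zero_norm' ?_ tendsto_one_div_add_atTop_nhds_zero_nat
    filter_upwards [eventually_ge_atTop i, eventually_ge_atTop j] with N hi hj
    exact (hclose N y i hi j hj hy).le
  have hall : ∀ᶠ N in atTop, ∀ b ∈ Ω, ‖θ N b - σ N b‖ < ε := by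
    rw [hΩ.eventually_all]
    intro b hb
    have := UCPFamily.agree_of_mem_topologicalClosure (fullOrbit_subset_unitary α hx) hgen
      (hΩx b hb)
    have := (tendsto_zero_iff_norm_tendsto_zero.mp this).eventually (gt_mem_nhds hε)
    exact this
  obtain ⟨N, hN⟩ := hall.exists
  exact (hle N).not_gt (hN _ (ha N))

/-- Approximations of the orbit of a unitary `x` yield approximations of the orbit of a finite
subset of the C*-algebra generated by the full orbit of `x`. -/
theorem rcp_le_rcpUnital (α : A ≃⋆ₐ[ℂ] A) {x : A} (π : FaithfulRep.{u, v} A)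
    (hπ : π.hom 1 = 1) (B : NonUnitalStarSubalgebra ℂ A) [IsClosed (B : Set A)]
    (hB : α '' (B : Set A) = B) (ρ : FaithfulRep.{u, w} B) {Ω : Set B} {ε δ : ℝ} {N : ℕ}
    (h : ∀ (θ : A →ₗ[ℂ] (π.H →L[ℂ] π.H)) (σ : A →⋆ₙₐ[ℂ] (π.H →L[ℂ] π.H)),
      KernelPositive θ → θ 1 = 1 → σ 1 = 1 →
      (∀ y, ∀ i ≤ N, ∀ j ≤ N, (⇑α)^[j] y = (⇑α)^[i] x → ‖θ y - σ y‖ < δ) →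
      ∀ a ∈ ((↑) : B → A) '' Ω, ‖θ a - σ a‖ < ε) (n : ℕ) :
    rcp ρ (orbit (restrict α B hB) Ω n) ε ≤ rcpUnital π (orbit α {x} (n + 2 * N)) δ := by
  refine le_iInf fun T => ?_
  let ι : B →⋆ₙₐ[ℂ] A := NonUnitalStarSubalgebraClass.subtype B
  -- Precomposing with `αᴺ` makes the negative times down to `-N` nonnegative; `E` then returns from
  -- the twisted representation to `ρ`.
  obtain ⟨E, hE, hEc, hEρ⟩ := exists_change_of_rep ((π.hom.comp (powHom α N)).comp ι)
    (π.injective.comp ((powHom_injective α N).comp Subtype.val_injective)) ρ.hom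
  have hθ : KernelPositive (T.ψ ∘ₗ T.φ) := (T.ψ_cp.comp T.φ_cp).kernelPositive
  let T' : CPA ρ (orbit (restrict α B hB) Ω n) ε :=
    { F := T.F
      φ := T.φ ∘ₗ homLin ((powHom α N).comp ι)
      ψ := E ∘ₗ T.ψ
      φ_cp := T.φ_cp.comp (isCompletelyPositive_homLin _)
      ψ_cp := hE.isCompletelyPositive.comp T.ψ_cp
      φ_contractive := fun a => (T.φ_contractive _).trans
        (NonUnitalStarAlgHom.norm_apply_le ((powHom α N).comp ι) a)
      ψ_contractive := fun a => (hEc _).trans (T.ψ_contractive _)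
      approx := by
        intro a ha
        obtain ⟨k, hk, ω, hω, rfl⟩ := mem_orbit.mp ha
        rw [← hEρ]
        change ‖E (T.ψ (T.φ (powHom α N (ι _)))) - E (π.hom (powHom α N (ι _)))‖ < ε
        rw [← map_sub]
        refine (hEc _).trans_lt ?_
        have e1 : powHom α N (ι ((⇑(restrict α B hB))^[k] ω)) = powHom α (N + k) (ω : A) := by
          rw [powHom_apply, powHom_apply, Function.iterate_add_apply, ← coe_restrict_iterate α B hB]
          rfl
        rw [e1]
        refine h ((T.ψ ∘ₗ T.φ) ∘ₗ homLin (powHom α (N + k))) (π.hom.comp (powHom α (N + k)))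
          ?_ ?_ ?_ ?_ ω ⟨ω, hω, rfl⟩
        · exact ((T.ψ_cp.comp T.φ_cp).comp (isCompletelyPositive_homLin _)).kernelPositive
        · change T.ψ (T.φ (powHom α (N + k) 1)) = 1
          rw [powHom_one, T.φ_one, T.ψ_one]
        · change π.hom (powHom α (N + k) 1) = 1
          rw [powHom_one, hπ]
        · intro y i hi j hj hy
          change ‖T.ψ (T.φ (powHom α (N + k) y)) - π.hom (powHom α (N + k) y)‖ < δ
          -- Here `y` is `x` moved by time `i - j`, so `αᴺ⁺ᵏ y` sits at a time between `k` and `k +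
          -- 2N`; this is why `n + 2N` steps are needed.
          refine T.approx _ (mem_orbit.mpr ⟨N + k - j + i, by omega, x, rfl, ?_⟩)
          rw [Function.iterate_add_apply, ← hy, ← Function.iterate_add_apply, powHom_apply,
            Nat.sub_add_cancel (by omega)] }
  exact iInf_le (fun T : CPA ρ (orbit (restrict α B hB) Ω n) ε => (fdRank T.F : ℕ∞)) T'

theorem htUnital_pos_of_hasCompletelyPositiveEntropy [Nontrivial A] (α : A ≃⋆ₐ[ℂ] A)
    (π : FaithfulRep.{u, v} A) (hπ : π.hom 1 = 1)
    (ρ : ∀ (B : NonUnitalStarSubalgebra ℂ A) [IsClosed (B : Set A)], FaithfulRep.{u, w} B)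
    (h : HasCompletelyPositiveEntropy ρ α) {x : A} (hx : x ∈ unitary A) (hxs : x ∉ scalars A) :
    0 < htUnital π α {x} := by
  by_contra hneg
  have hcl := isClosed_orbitAlgebra α x
  have hB := image_orbitAlgebra α x
  have hmem := mem_orbitAlgebra_self α x
  have hpos := h (orbitAlgebra α x) hB (by
    intro h0
    rw [h0] at hmem
    have hx0 : x = 0 := NonUnitalStarAlgebra.mem_bot.mp hmem
    have := Unitary.star_mul_self_of_mem hx
    rw [hx0, mul_zero] at this
    exact zero_ne_one this) (fun h0 => hxs (h0 ▸ hmem))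
  rw [ht, lt_iSup_iff] at hpos
  obtain ⟨Ω, hpos⟩ := hpos
  rw [lt_iSup_iff] at hpos
  obtain ⟨hΩ, hpos⟩ := hpos
  rw [htLocal, lt_iSup_iff] at hpos
  obtain ⟨ε, hpos⟩ := hpos
  rw [lt_iSup_iff] at hpos
  obtain ⟨hε, hpos⟩ := hpos
  obtain ⟨N, δ, hδ, hagree⟩ := exists_uniform_agree α hx π.H (hΩ.image _)
    (by rintro _ ⟨a, -, rfl⟩; exact a.2) hε
  refine hpos.not_ge (growthRate_le_zero_of_le
    (r := fun n => rcpUnital π (orbit α {x} n) δ) (2 * N)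
    (fun n => (rcp_le_rcpUnital α π hπ _ hB (ρ _) hagree n).trans (le_sq_add_one_sq _)) ?_)
  exact (le_iSup₂ (f := fun (δ : ℝ) (_ : 0 < δ) =>
    growthRate fun n => rcpUnital π (orbit α {x} n) δ) δ hδ).trans (not_lt.mp hneg)

end Generation

/-! ### Non-scalar unitaries in `B + ℂ1`. -/

section UnitaryElement

open scoped ComplexStarModule

variable {A : Type u} [CStarAlgebra A]

theorem smul_mem_scalars (c : ℂ) {x : A} (hx : x ∈ scalars A) : c • x ∈ scalars A := by
  obtain ⟨d, rfl⟩ := hx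
  exact ⟨c * d, by rw [map_mul, Algebra.smul_def]⟩

theorem add_mem_scalars {x y : A} (hx : x ∈ scalars A) (hy : y ∈ scalars A) :
    x + y ∈ scalars A := by
  obtain ⟨c, rfl⟩ := hx
  obtain ⟨d, rfl⟩ := hy
  exact ⟨c + d, map_add _ _ _⟩

theorem star_mem_scalars {x : A} (hx : x ∈ scalars A) : star x ∈ scalars A := by
  obtain ⟨c, rfl⟩ := hx
  exact ⟨star c, algebraMap_star_comm c⟩

/-- If all self-adjoint elements were scalar, so would be all elements, and a subspace of `ℂ1` is
zero or everything. -/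
theorem exists_isSelfAdjoint_notMem_scalars {B : NonUnitalStarSubalgebra ℂ A} (hB : B ≠ ⊥)
    (hBs : (B : Set A) ≠ scalars A) : ∃ h ∈ B, IsSelfAdjoint h ∧ h ∉ scalars A := by
  by_contra! hcon
  have hsub : ∀ x ∈ B, x ∈ scalars A := by
    intro x hx
    have h1 := hcon (x + star x) (add_mem hx (star_mem hx)) (IsSelfAdjoint.add_star_self x)
    have h2 := hcon (Complex.I • (x - star x))
      (SMulMemClass.smul_mem _ (sub_mem hx (star_mem hx))) (by
        rw [IsSelfAdjoint, star_smul, star_sub, star_star, Complex.star_def, Complex.conj_I]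
        module)
    have := add_mem_scalars (smul_mem_scalars (1 / 2) h1) (smul_mem_scalars (-Complex.I / 2) h2)
    convert this using 1
    rw [smul_smul, show -Complex.I / 2 * Complex.I = 1 / 2 by
      linear_combination (-1 / 2 : ℂ) * Complex.I_sq]
    module
  obtain ⟨x, hx, hx0⟩ : ∃ x ∈ B, x ≠ 0 := by
    by_contra! h
    exact hB (eq_bot_iff.mpr fun x hx => NonUnitalStarAlgebra.mem_bot.mpr (h x hx))
  refine hBs (Set.Subset.antisymm hsub ?_)
  rintro _ ⟨c, rfl⟩
  obtain ⟨d, rfl⟩ := hsub x hx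
  have hd : d ≠ 0 := fun h => hx0 (by rw [h, map_zero])
  have : algebraMap ℂ A c = (c / d) • algebraMap ℂ A d := by
    rw [Algebra.smul_def, ← map_mul, div_mul_cancel₀ c hd]
  rw [this]
  exact SMulMemClass.smul_mem _ hx

/-- Apart from the zero algebra and the scalars, every C*-subalgebra has a non-scalar unitary in
its unitization. -/
theorem exists_nonscalar_unitary {B : NonUnitalStarSubalgebra ℂ A} [hcl : IsClosed (B : Set A)]
    (hB : B ≠ ⊥) (hBs : (B : Set A) ≠ scalars A) :
    ∃ b ∈ B, ∃ c : ℂ, b + c • (1 : A) ∈ unitary A ∧ b + c • (1 : A) ∉ scalars A := by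
  let _ : PartialOrder A := CStarAlgebra.spectralOrder A
  have _ : StarOrderedRing A := CStarAlgebra.spectralOrderedRing A
  obtain ⟨h, hh, hsa, hns⟩ := exists_isSelfAdjoint_notMem_scalars hB hBs
  have h0 : h ≠ 0 := fun h0 => hns ⟨0, by rw [map_zero, h0]⟩
  have hnorm : ‖h‖ ≠ 0 := norm_ne_zero_iff.mpr h0
  obtain ⟨a, ha, hasa, hans, han⟩ :
      ∃ a ∈ B, IsSelfAdjoint a ∧ a ∉ scalars A ∧ ‖a‖ ≤ 1 := by
    refine ⟨((‖h‖⁻¹ : ℝ) : ℂ) • h, SMulMemClass.smul_mem _ hh, ?_, fun hs => hns ?_, ?_⟩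
    · rw [IsSelfAdjoint, star_smul, hsa.star_eq, Complex.star_def, Complex.conj_ofReal]
    · have := smul_mem_scalars (‖h‖ : ℂ) hs
      rwa [smul_smul, ← Complex.ofReal_mul, mul_inv_cancel₀ hnorm, Complex.ofReal_one,
        one_smul] at this
    · rw [norm_smul, Complex.norm_real, norm_inv, norm_norm, inv_mul_cancel₀ hnorm]
  -- The unitary is `a + i√(1 - a²)`. Subtracting `1` from the root gives a function vanishing at
  -- `0`, whose value at `a` stays in the possibly non-unital `B`.
  have hk : CFC.sqrt (1 - a ^ 2) = cfcₙ (fun t : ℝ => √(1 - t ^ 2) - 1) a + 1 := by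
    rw [CFC.sqrt_eq_real_sqrt (1 - a ^ 2) ?nonneg]
    case nonneg =>
      obtain (_ | _) := subsingleton_or_nontrivial A
      · exact (Subsingleton.elim _ _).le
      rwa [sub_nonneg, ← CStarAlgebra.norm_le_one_iff_of_nonneg (a ^ 2), sq, hasa.norm_mul_self,
        sq_le_one_iff₀ (by positivity)]
    rw [cfcₙ_eq_cfc, cfcₙ_eq_cfc, cfc_sub .., cfc_const_one .., sub_add_cancel,
      cfc_comp' (√·) (1 - · ^ 2) a, cfc_sub .., cfc_pow .., cfc_const_one .., cfc_id' ..]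
  have hu := IsSelfAdjoint.self_add_I_smul_cfcSqrt_sub_sq_mem_unitary a hasa han
  rw [hk] at hu
  refine ⟨a + Complex.I • cfcₙ (fun t : ℝ => √(1 - t ^ 2) - 1) a,
    add_mem ha (SMulMemClass.smul_mem _ (cfcₙ_mem _ ha)), Complex.I, ?_, fun hs => hans ?_⟩
  · rwa [add_assoc, ← smul_add]
  -- The real part of the unitary is `a`, which is not scalar.
  · rw [add_assoc, ← smul_add, ← hk] at hs
    have := smul_mem_scalars (1 / 2) (add_mem_scalars hs (star_mem_scalars hs))
    convert this using 1
    rw [star_add, star_smul, hasa.star_eq,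
      (CFC.sqrt_nonneg (1 - a ^ 2 : A)).isSelfAdjoint.star_eq, Complex.star_def, Complex.conj_I]
    module

end UnitaryElement

/-! ### From unitaries to positive entropy of subalgebras. -/

section Unitalization

open scoped ComplexOrder InnerProductSpace
open Matrix

variable {A : Type u} [CStarAlgebra A]
variable {K : Type*} [NormedAddCommGroup K] [InnerProductSpace ℂ K] [CompleteSpace K]

theorem exists_one_sub_eq_star_mul_self {A : Type*} [CStarAlgebra A] {n : A}
    (hn : ‖star n * n‖ ≤ 1) : ∃ c : A, 1 - star n * n = star c * c := by
  let _ : PartialOrder A := CStarAlgebra.spectralOrder A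
  have _ : StarOrderedRing A := CStarAlgebra.spectralOrderedRing A
  obtain (_ | _) := subsingleton_or_nontrivial A
  · exact ⟨0, Subsingleton.elim _ _⟩
  · refine nonneg_iff_exists_star_mul_self.mp ?_
    rwa [sub_nonneg, ← CStarAlgebra.norm_le_one_iff_of_nonneg _ (star_mul_self_nonneg n)]

theorem KernelPositive.exists_map_one_eq {φ : A →ₗ[ℂ] (K →L[ℂ] K)} (h : KernelPositive φ) :
    ∃ n, φ 1 = star n * n := by
  obtain ⟨N, hN⟩ := (isCompletelyPositive_iff φ).mp h.isCompletelyPositive 1 1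
  refine ⟨N 0 0, ?_⟩
  have := congrFun (congrFun hN 0) 0
  simpa [Matrix.mul_apply] using this

/-- The zero algebra does not contain the unit of `A`, so its zero map has a unital extension. -/
theorem exists_unital_kernelPositive [Nontrivial A] :
    ∃ ω : A →ₗ[ℂ] (K →L[ℂ] K), KernelPositive ω ∧ ω 1 = 1 := by
  obtain ⟨ω, h, -, -, h1⟩ := exists_contractive_extension (A := A) (K := K)
    (0 : (Fin 0 → ℂ) →⋆ₙₐ[ℂ] A) (fun _ _ _ => Subsingleton.elim _ _) 0
    (fun k a x => by simp) (fun b => by simp)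
  exact ⟨ω, h, h1 (by rintro ⟨x, hx⟩; exact zero_ne_one hx)⟩

/-- A contractive completely positive map is corrected to a unital one; on unitaries the error is
controlled by the error at the unit. -/
theorem KernelPositive.exists_unital_correction [Nontrivial A] {Φ : A →ₗ[ℂ] (K →L[ℂ] K)}
    (h : KernelPositive Φ) (h1 : ‖Φ 1‖ ≤ 1) :
    ∃ Φ' : A →ₗ[ℂ] (K →L[ℂ] K), KernelPositive Φ' ∧ Φ' 1 = 1 ∧
      ∀ {L : Type*} [NormedAddCommGroup L] [InnerProductSpace ℂ L] [CompleteSpace L]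
        (Ψ : (K →L[ℂ] K) →ₗ[ℂ] (L →L[ℂ] L)), KernelPositive Ψ → Ψ 1 = 1 → ∀ y : A,
        ‖Ψ (Φ' y) - Ψ (Φ y)‖ ≤ ‖1 - Ψ (Φ 1)‖ * ‖y‖ := by
  obtain ⟨n, hn⟩ := h.exists_map_one_eq
  obtain ⟨c, hc⟩ := exists_one_sub_eq_star_mul_self (n := n) (hn ▸ h1)
  rw [← hn] at hc
  obtain ⟨ω, hω, hω1⟩ := exists_unital_kernelPositive (A := A) (K := K)
  -- The summand `c* ω(·) c` is completely positive and supplies the missing `1 - Φ 1` at the unit.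
  let C : A →ₗ[ℂ] (K →L[ℂ] K) := LinearMap.mulLeft ℂ (star c) ∘ₗ LinearMap.mulRight ℂ c ∘ₗ ω
  have hCapp : ∀ y, C y = star c * (ω y * c) := fun y => rfl
  have hC : KernelPositive C := by
    intro k a x
    refine (hω k a fun i => c (x i)).trans_eq
      (Finset.sum_congr rfl fun i _ => Finset.sum_congr rfl fun j _ => ?_)
    rw [hCapp, mul_apply_eq_comp, ContinuousLinearMap.star_eq_adjoint,
      ContinuousLinearMap.adjoint_inner_right]
    rfl
  have hC1 : C 1 = 1 - Φ 1 := by rw [hCapp, hω1, one_mul, hc]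
  refine ⟨Φ + C, ?_, ?_, ?_⟩
  · intro k a x
    have := add_nonneg (h k a x) (hC k a x)
    simpa only [LinearMap.add_apply, _root_.add_apply, inner_add_right,
      Finset.sum_add_distrib] using this
  · rw [LinearMap.add_apply, hC1, add_sub_cancel]
  · intro L _ _ _ Ψ hΨ hΨ1 y
    -- The norm of a completely positive map is attained at the unit. The estimate is made after `Ψ`
    -- because `Φ 1` itself need not be near `1`; only `Ψ (Φ 1)` is.
    have hΨC : KernelPositive (Ψ ∘ₗ C) :=
      (hΨ.isCompletelyPositive.comp hC.isCompletelyPositive).kernelPositive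
    have := hΨC.norm_le y
    change ‖Ψ (C y)‖ ≤ ‖Ψ (C 1)‖ * ‖y‖ at this
    rw [hC1, map_sub, hΨ1] at this
    rwa [LinearMap.add_apply, map_add, add_sub_cancel_left]

/-- An approximation of a subalgebra factors through the operators on a finite-dimensional Hilbert
space by maps that are defined on the ambient algebra, the second one of them unital. -/
theorem exists_ambient_approximation (π : FaithfulRep.{u, v} A)
    (B : NonUnitalStarSubalgebra ℂ A) [IsClosed (B : Set A)] (ρ : FaithfulRep.{u, w} B)
    {X : Set B} {δ : ℝ} (T : CPA ρ X δ) :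
    ∃ (K : Type) (_ : NormedAddCommGroup K) (_ : InnerProductSpace ℂ K) (_ : CompleteSpace K)
      (_ : FiniteDimensional ℂ K) (Φ : A →ₗ[ℂ] (K →L[ℂ] K))
      (Ψ : (K →L[ℂ] K) →ₗ[ℂ] (π.H →L[ℂ] π.H)), KernelPositive Φ ∧ (∀ a, ‖Φ a‖ ≤ ‖a‖) ∧
      ((1 : A) ∉ B → Φ 1 = 1) ∧ KernelPositive Ψ ∧ Ψ 1 = 1 ∧
      (∀ b ∈ X, ‖Ψ (Φ b) - π.hom b‖ < δ) ∧
      Module.finrank ℂ K ^ 2 ≤ (fdRank T.F ^ 2 + 1) ^ 2 := by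
  -- Since the image of `F` misses the unit of `B(K)`, the extension of the second map can be chosen
  -- unital whatever its value at the unit of `F`.
  obtain ⟨K, _, _, _, _, j, hj, hj1, hK⟩ := exists_nonunital_embedding T.F
  let ι : B →⋆ₙₐ[ℂ] A := NonUnitalStarSubalgebraClass.subtype B
  obtain ⟨E, hE, hEc, hEρ⟩ := exists_change_of_rep ρ.hom ρ.injective (π.hom.comp ι)
  obtain ⟨Φ, hΦ, hΦc, hΦι, hΦ1⟩ := exists_contractive_extension ι Subtype.val_injective
    (homLin j ∘ₗ T.φ) ((isCompletelyPositive_homLin j).comp T.φ_cp).kernelPositive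
    fun b => (NonUnitalStarAlgHom.norm_apply_le j _).trans (T.φ_contractive b)
  obtain ⟨Ψ, hΨ, -, hΨj, hΨ1⟩ := exists_contractive_extension j hj (E ∘ₗ T.ψ)
    (hE.isCompletelyPositive.comp T.ψ_cp).kernelPositive
    fun x => (hEc _).trans (T.ψ_contractive x)
  refine ⟨K, _, _, inferInstance, inferInstance, Φ, Ψ, hΦ, hΦc, fun h => hΦ1 ?_, hΨ, hΨ1 hj1,
    fun b hb => ?_, ?_⟩
  · rintro ⟨b, hb⟩
    exact h (hb ▸ b.2)
  · have e1 : Ψ (Φ b) = E (T.ψ (T.φ b)) := (congrArg Ψ (hΦι b)).trans (hΨj _)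
    have e2 : π.hom b = E (ρ.hom b) := (hEρ b).symm
    rw [e1, e2, ← map_sub]
    exact (hEc _).trans_lt (T.approx b hb)
  · rw [hK]
    gcongr
    exact finrank_le_fdRank_sq T.F

/-- Unital approximations assembled from completely positive maps through matrix algebras. -/
theorem rcpUnital_le (π : FaithfulRep.{u, v} A) {Y : Set A} {δ : ℝ} {K : Type}
    [NormedAddCommGroup K] [InnerProductSpace ℂ K] [CompleteSpace K] [FiniteDimensional ℂ K]
    {Φ : A →ₗ[ℂ] (K →L[ℂ] K)} {Ψ : (K →L[ℂ] K) →ₗ[ℂ] (π.H →L[ℂ] π.H)} (hΦ : KernelPositive Φ)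
    (hΦ1 : Φ 1 = 1) (hΨ : KernelPositive Ψ) (hΨ1 : Ψ 1 = 1)
    (happ : ∀ y ∈ Y, ‖Ψ (Φ y) - π.hom y‖ < δ) :
    rcpUnital π Y δ ≤ (Module.finrank ℂ K ^ 2 : ℕ) := by
  have _ : FiniteDimensional ℂ (K →L[ℂ] K) :=
    LinearEquiv.finiteDimensional (LinearMap.toContinuousLinearMap (𝕜 := ℂ) (E := K) (F' := K))
  let T : UnitalCPA π Y δ :=
    { F := K →L[ℂ] K
      φ := Φ
      ψ := Ψ
      φ_cp := hΦ.isCompletelyPositive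
      ψ_cp := hΨ.isCompletelyPositive
      φ_contractive := hΦ.contractive hΦ1
      ψ_contractive := hΨ.contractive hΨ1
      approx := happ
      φ_one := hΦ1
      ψ_one := hΨ1 }
  refine (iInf_le (fun T : UnitalCPA π Y δ => (fdRank T.F : ℕ∞)) T).trans ?_
  rw [← finrank_continuousLinearMap_self]
  exact_mod_cast fdRank_le_finrank (K →L[ℂ] K)

/-- The orbit of a unitary in the unitization of a subalgebra is approximated by approximating
orbits in the subalgebra. -/
theorem exists_rcpUnital_le [Nontrivial A] (α : A ≃⋆ₐ[ℂ] A) (π : FaithfulRep.{u, v} A)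
    (hπ : π.hom 1 = 1) (B : NonUnitalStarSubalgebra ℂ A) [IsClosed (B : Set A)]
    (hB : α '' (B : Set A) = B) (ρ : FaithfulRep.{u, w} B) {b : A} (hb : b ∈ B) {c : ℂ}
    (hu : b + c • (1 : A) ∈ unitary A) {δ : ℝ} (hδ : 0 < δ) :
    ∃ Ω : Set B, Ω.Finite ∧ ∃ δ' > 0, ∀ n, rcpUnital π (orbit α {b + c • (1 : A)} n) δ ≤
      (rcp ρ (orbit (restrict α B hB) Ω n) δ' ^ 2 + 1) ^ 2 := by
  have hsuff : ∀ (Ω : Set B) (δ' : ℝ) (n : ℕ),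
      (∀ T : CPA ρ (orbit (restrict α B hB) Ω n) δ',
        rcpUnital π (orbit α {b + c • (1 : A)} n) δ ≤ ((fdRank T.F ^ 2 + 1) ^ 2 : ℕ)) →
      rcpUnital π (orbit α {b + c • (1 : A)} n) δ ≤
        (rcp ρ (orbit (restrict α B hB) Ω n) δ' ^ 2 + 1) ^ 2 := by
    intro Ω δ' n h
    rcases isEmpty_or_nonempty (CPA ρ (orbit (restrict α B hB) Ω n) δ') with he | he
    · rw [rcp, iInf_of_empty]
      simp
    · obtain ⟨T, hT⟩ := ENat.exists_eq_iInf
        fun T : CPA ρ (orbit (restrict α B hB) Ω n) δ' => (fdRank T.F : ℕ∞)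
      rw [rcp, ← hT]
      exact_mod_cast h T
  by_cases h1 : (1 : A) ∈ B
  · have huB : b + c • (1 : A) ∈ B := add_mem hb (SMulMemClass.smul_mem c h1)
    -- The unit is included so that `Ψ (Φ 1)` is close to `1`; half of `δ` pays for the unital
    -- correction.
    refine ⟨{⟨_, huB⟩, ⟨1, h1⟩}, (Set.finite_singleton _).insert _, δ / 2, half_pos hδ,
      fun n => hsuff _ _ n fun T => ?_⟩
    obtain ⟨K, _, _, _, _, Φ, Ψ, hΦ, hΦc, -, hΨ, hΨ1, happ, hK⟩ :=
      exists_ambient_approximation π B ρ T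
    obtain ⟨Φ', hΦ', hΦ'1, herr⟩ := hΦ.exists_unital_correction
      ((hΦc 1).trans (norm_one_le_one A))
    refine (rcpUnital_le π hΦ' hΦ'1 hΨ hΨ1 fun y hy => ?_).trans (by exact_mod_cast hK)
    obtain ⟨i, hi, x, rfl, rfl⟩ := mem_orbit.mp hy
    have e1 := happ _ (mem_orbit.mpr ⟨i, hi, _, Set.mem_insert _ _, rfl⟩)
    have e2 := happ _ (mem_orbit.mpr ⟨i, hi, _, Set.mem_insert_of_mem _ rfl, rfl⟩)
    rw [coe_restrict_iterate] at e1 e2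
    rw [← powHom_apply, powHom_one, hπ, norm_sub_rev] at e2
    have e3 := herr Ψ hΨ hΨ1 ((⇑α)^[i] (b + c • (1 : A)))
    rw [CStarRing.norm_of_mem_unitary (iterate_mem_unitary α hu i), mul_one] at e3
    calc _ = ‖(Ψ (Φ' ((⇑α)^[i] (b + c • (1 : A)))) - Ψ (Φ ((⇑α)^[i] (b + c • (1 : A))))) +
          (Ψ (Φ ((⇑α)^[i] (b + c • (1 : A)))) - π.hom ((⇑α)^[i] (b + c • (1 : A))))‖ := by
            rw [sub_add_sub_cancel]
      _ ≤ _ := norm_add_le _ _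
      _ < δ / 2 + δ / 2 := add_lt_add (e3.trans_lt e2) e1
      _ = δ := add_halves δ
  · refine ⟨{⟨b, hb⟩}, Set.finite_singleton _, δ, hδ, fun n => hsuff _ _ n fun T => ?_⟩
    obtain ⟨K, _, _, _, _, Φ, Ψ, hΦ, -, hΦ1, hΨ, hΨ1, happ, hK⟩ :=
      exists_ambient_approximation π B ρ T
    refine (rcpUnital_le π hΦ (hΦ1 h1) hΨ hΨ1 fun y hy => ?_).trans (by exact_mod_cast hK)
    obtain ⟨i, hi, x, rfl, rfl⟩ := mem_orbit.mp hy
    have e1 := happ _ (mem_orbit.mpr ⟨i, hi, _, rfl, rfl⟩)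
    rw [coe_restrict_iterate, ← powHom_apply] at e1
    -- All the maps are unital, so the scalar part `c1` cancels exactly and only the error at the
    -- orbit of `b` remains.
    rw [← powHom_apply, map_add, map_smul, powHom_one, map_add, map_smul, hΦ1 h1, map_add,
      map_smul, hΨ1, map_add, map_smul, hπ, add_sub_add_right_eq_sub]
    exact e1

theorem hasCompletelyPositiveEntropy_of_htUnital_pos [Nontrivial A] (α : A ≃⋆ₐ[ℂ] A)
    (π : FaithfulRep.{u, v} A) (hπ : π.hom 1 = 1)
    (ρ : ∀ (B : NonUnitalStarSubalgebra ℂ A) [IsClosed (B : Set A)], FaithfulRep.{u, w} B)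
    (h : ∀ x ∈ unitary A, x ∉ scalars A → 0 < htUnital π α {x}) :
    HasCompletelyPositiveEntropy ρ α := by
  intro B _ hB hB0 hBs
  obtain ⟨b, hb, c, hu, hus⟩ := exists_nonscalar_unitary hB0 hBs
  have hpos := h _ hu hus
  rw [htUnital, lt_iSup_iff] at hpos
  obtain ⟨δ, hpos⟩ := hpos
  rw [lt_iSup_iff] at hpos
  obtain ⟨hδ, hpos⟩ := hpos
  obtain ⟨Ω, hΩ, δ', hδ', hle⟩ := exists_rcpUnital_le α π hπ B hB (ρ B) hb hu hδ
  by_contra hneg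
  refine hpos.not_ge (growthRate_le_zero_of_le
    (r := fun n => rcp (ρ B) (orbit (restrict α B hB) Ω n) δ') 0 hle ?_)
  exact ((le_iSup₂ (f := fun (δ : ℝ) (_ : 0 < δ) =>
    growthRate fun n => rcp (ρ B) (orbit (restrict α B hB) Ω n) δ) δ' hδ').trans
    (le_iSup₂ (f := fun (Ω : Set B) (_ : Ω.Finite) => htLocal (ρ B) (restrict α B hB) Ω)
      Ω hΩ)).trans (not_lt.mp hneg)

end Unitalization

end VoiculescuBrown

end

theorem mainTheorem4 {A : Type u} [CStarAlgebra A] [Nontrivial A]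
    (hA : VoiculescuBrown.IsExact A) (α : A ≃⋆ₐ[ℂ] A)
    (π : VoiculescuBrown.FaithfulRep.{u, v} A) (hπ : π.hom 1 = 1)
    (ρ : ∀ (B : NonUnitalStarSubalgebra ℂ A) [IsClosed (B : Set A)],
      VoiculescuBrown.FaithfulRep.{u, w} B) :
    VoiculescuBrown.HasCompletelyPositiveEntropy ρ α ↔
      ∀ x ∈ unitary A, x ∉ VoiculescuBrown.scalars A →
        0 < VoiculescuBrown.htUnital π α {x} :=
  ⟨fun h _ hx hxs =>
      VoiculescuBrown.htUnital_pos_of_hasCompletelyPositiveEntropy α π hπ ρ h hx hxs,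
    VoiculescuBrown.hasCompletelyPositiveEntropy_of_htUnital_pos α π hπ ρ⟩
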